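/- For $0<p<1$ let $\mathcal A\subseteq\mathbb Z_{>0}$ be a random set that contains each positive integer independently with probability $p$, and let $\langle\mathcal A\rangle=\{a_1+\cdots+a_k : k\ge 0,\ a_1,\dots,a_k\in\mathcal A\}$. A numerical semigroup is a co-finite subset $S\subseteq\mathbb Z_{\ge 0}$ that contains $0$ and is closed under addition; its genus is $g(S)=|\mathbb Z_{>0}\setminus S|$, its Frobenius number is $F(S)=\max(\mathbb Z_{>0}\setminus S)$ (with $F(\mathbb Z_{\ge 0})=-1$), and its embedding dimension is $e(S)=\min\{|B| : B\subseteq\mathbb Z_{>0},\ \langle B\rangle=S\}$. Theorem. For every $0<p<1$, $\langle\mathcal A\rangle$ is almost surely a numerical semigroup. Moreover, there are absolute constants $c,C>0$ such that the following hold. (1) With probability tending to $1$ as $p\to0^+$, $\langle\mathcal A\rangle$ is a numerical semigroup with $$c\,p^{-1}(\log p^{-1})^2\le g(\langle\mathcal A\rangle),\,F(\langle\mathcal A\rangle)\le C\,p^{-1}(\log p^{-1})^2\quad\text{and}\quad c\,(\log p^{-1})^2\le e(\langle\mathcal A\rangle)\le C\,(\log p^{-1})^2 .$$ (2) For all sufficiently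 small $p>0$, $g(\langle\mathcal A\rangle)$, $F(\langle\mathcal A\rangle)$ and $e(\langle\mathcal A\rangle)$ have finite expectations, and $$c\,p^{-1}(\log p^{-1})^2\le \mathbb E\, g(\langle\mathcal A\rangle),\ \mathbb E\, F(\langle\mathcal A\rangle)\le C\,p^{-1}(\log p^{-1})^2\quad\text{and}\quad c\,(\log p^{-1})^2\le \mathbb E\, e(\langle\mathcal A\rangle)\le C\,(\log p^{-1})^2 .$$ -/

import Mathlib

open MeasureTheory Filter ProbabilityTheory
open scoped Topology unitInterval

noncomputable section

namespace RandomSemigroup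

/-- The law of the density-`p` random set `𝒜 ⊆ ℤ_{>0}`: every positive integer belongs to `𝒜`
independently with probability `p` (and `0` never does). -/
def randomSet (p : I) : Measure (Set ℕ) := setBernoulli {n : ℕ | 0 < n} p

/-- The semigroup `⟨A⟩` of all finite sums (the empty sum included) of elements of `A`. -/
abbrev gen (A : Set ℕ) : AddSubmonoid ℕ := AddSubmonoid.closure A

/-- The gaps of `S`: the positive integers that are not in `S`. -/
def gaps (S : AddSubmonoid ℕ) : Set ℕ := {n | 0 < n ∧ n ∉ S}

/-- A numerical semigroup: a cofinite submonoid of `ℤ_{≥0}`. -/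
def IsNumericalSemigroup (S : AddSubmonoid ℕ) : Prop := ((S : Set ℕ)ᶜ).Finite

open Classical in
/-- The Frobenius number of a numerical semigroup, the largest gap, with the convention
`F(ℤ_{≥0}) = -1`. -/
def frobeniusNum (S : AddSubmonoid ℕ) : ℤ :=
  if gaps S = ∅ then -1 else ((sSup (gaps S) : ℕ) : ℤ)

/-- The genus of a numerical semigroup: the number of gaps. -/
def genus (S : AddSubmonoid ℕ) : ℕ := (gaps S).ncard

/-- The embedding dimension: the least size of a (finite) set of positive integers that
generates `S`. (Every submonoid of `ℕ` is finitely generated, so the minimum exists.) -/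
def embDim (S : AddSubmonoid ℕ) : ℕ :=
  sInf {k : ℕ | ∃ B : Finset ℕ, (∀ b ∈ B, 0 < b) ∧ gen (B : Set ℕ) = S ∧ B.card = k}

/-- `c * x ≤ y ≤ C * x`. -/
def Between (c C x y : ℝ) : Prop := c * x ≤ y ∧ y ≤ C * x

/-- `p⁻¹ (log p⁻¹)²` -/
def scaleFG (p : ℝ) : ℝ := p⁻¹ * Real.log p⁻¹ ^ 2

/-- `(log p⁻¹)²` -/
def scaleE (p : ℝ) : ℝ := Real.log p⁻¹ ^ 2

end RandomSemigroup

end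

/-!
Write `L = log p⁻¹`.

*Upper bounds.* Fix a window `{1, …, W}` and a modulus `m ≤ W`. The law of a uniformly random subset
sum of `A ∩ {1, …, mq}` modulo `m`, where `q = ⌊W / m⌋`, has Fourier coefficient
`∏ (1 + ψ a) / 2` at the character `ψ`. Its squared absolute value is `∏ (1 + Re ψ a) / 2`, whose
expectation over `A` is at most `exp (-p m q / 2)` for `ψ ≠ 0`, because `ψ` sums to zero over
complete residue systems. As soon as all nontrivial coefficients are small, every residue modulo `m`
is a subset sum (`one_le_sum_prod_of_missed`). A union bound over `m ≤ W` takes care of the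
randomness of the modulus, and so one may take any `m ∈ A`, `m ≤ W`: every `n` that is at least the
sum of all of `A ∩ {1, …, W}`, which is rarely more than `3 p W ^ 2`, lies in `⟨A⟩`. All this fails
with probability at most `3 W ^ 3 exp (-p W / 4)` (`measureReal_not_goodWindow_le`). With `W` a large
multiple of `p⁻¹ L` this bounds the Frobenius number and the genus; since all minimal generators are
at most the conductor plus the least element of `A`, it also bounds the embedding dimension, by the
number of elements of `A` up to a multiple of `p⁻¹ L ^ 2`. The exponential decay in `W` gives the
expectations (`integrable_and_integral_le`) and, for fixed `p`, almost sure cofiniteness.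

*Lower bounds.* The number `Z` of elements of `⟨A⟩` in `{1, …, N}` is at most
`x ^ (-N) ∏ (1 - x ^ a)⁻¹` for every `0 < x < 1`, the product being over `a ∈ A`, `a ≤ N`. The
expected square root of the right-hand side is at most `x ^ (-N / 2) exp (2 p / (1 - x))`, and
`Z ≤ √N √Z`. With `N` a small multiple of `p⁻¹ L ^ 2` and `1 - x` of order `p / L` the expectation
of `Z` is a power of `p` smaller than `N` (`integral_countUpTo_gen_le`). Hence most integers up to
`N` are gaps. Moreover `n ∈ A` is independent of whether `n` is a sum of smaller elements of `A`, so
the expected number of redundant elements of `A` up to `N` is at most `p` times that of `Z`, which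
tends to zero: all of the about `p N` elements of `A` up to `N` are minimal generators.
-/

namespace RandomSemigroup

/-! ### Counting and the invariants of a submonoid of `ℕ` -/

open Classical in
/-- The number of elements of `S` in `{1, …, N}`. -/
noncomputable def countUpTo (S : Set ℕ) (N : ℕ) : ℕ := {n ∈ Finset.Icc 1 N | n ∈ S}.card

lemma countUpTo_le (S : Set ℕ) (N : ℕ) : countUpTo S N ≤ N := by
  classical
  simpa [countUpTo] using Finset.card_filter_le (Finset.Icc 1 N) (· ∈ S)

lemma countUpTo_eq_sum (S : Set ℕ) (N : ℕ) :
    (countUpTo S N : ℝ) = ∑ n ∈ Finset.Icc 1 N, S.indicator 1 n := by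
  classical
  simp [countUpTo, Set.indicator_apply]

/-- The elements of `A` that are sums of smaller elements of `A`. -/
def redundant (A : Set ℕ) : Set ℕ := {n | n ∈ A ∧ n ∈ gen (A ∩ Set.Iio n)}

lemma mem_gen_inter_Icc {A : Set ℕ} {n N : ℕ} (hn : n ∈ gen A) (h : n ≤ N) :
    n ∈ gen (A ∩ Set.Icc 1 N) := by
  induction hn using AddSubmonoid.closure_induction with
  | mem x hx =>
    rcases Nat.eq_zero_or_pos x with rfl | hx0
    · exact zero_mem _
    · exact AddSubmonoid.subset_closure ⟨hx, hx0, h⟩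
  | zero => exact zero_mem _
  | add x y _ _ hx hy => exact add_mem (hx (by omega)) (hy (by omega))

lemma gen_inter_Iio_le {A : Set ℕ} {n : ℕ} : gen (A ∩ Set.Iio n) ≤ gen A :=
  AddSubmonoid.closure_mono Set.inter_subset_left

lemma mem_gen_inter_Iio_of_notMem {A : Set ℕ} {n : ℕ} (hn : n ∈ gen A) (h : n ∉ A) :
    n ∈ gen (A ∩ Set.Iio n) := by
  refine AddSubmonoid.closure_mono ?_ (mem_gen_inter_Icc hn le_rfl)
  rintro x ⟨hx, hx1, hxn⟩
  exact ⟨hx, lt_of_le_of_ne hxn (fun e => h (e ▸ hx))⟩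

/-- Every generating set contains the elements of `A` that are not sums of smaller ones. -/
lemma mem_of_gen_eq {A B : Set ℕ} (hAB : gen B = gen A) {n : ℕ} (hn : n ∈ A)
    (hn' : n ∉ redundant A) : n ∈ B := by
  by_contra hB
  have h1 : n ∈ gen (B ∩ Set.Iio n) :=
    mem_gen_inter_Iio_of_notMem (hAB ▸ AddSubmonoid.subset_closure hn) hB
  refine hn' ⟨hn, (AddSubmonoid.closure_le.2 ?_ : gen (B ∩ Set.Iio n) ≤ gen (A ∩ Set.Iio n)) h1⟩
  rintro x ⟨hxB, hxn⟩
  have hxA : x ∈ gen A := hAB ▸ AddSubmonoid.subset_closure hxB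
  refine AddSubmonoid.closure_mono ?_ (mem_gen_inter_Icc hxA le_rfl)
  rintro y ⟨hy, -, hyx⟩
  exact ⟨hy, lt_of_le_of_lt hyx hxn⟩

lemma exists_finset_card_eq_embDim (S : AddSubmonoid ℕ) :
    ∃ B : Finset ℕ, (∀ b ∈ B, 0 < b) ∧ gen (B : Set ℕ) = S ∧ B.card = embDim S := by
  refine Nat.sInf_mem (s := {k : ℕ | ∃ B : Finset ℕ, (∀ b ∈ B, 0 < b) ∧ gen (B : Set ℕ) = S ∧
    B.card = k}) ?_
  obtain ⟨B, hB⟩ := Nat.addSubmonoid_fg S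
  refine ⟨_, B.erase 0, fun b hb => Nat.pos_of_ne_zero (Finset.ne_of_mem_erase hb), ?_, rfl⟩
  rw [← hB]
  apply le_antisymm
  · exact AddSubmonoid.closure_mono (by simp)
  · refine AddSubmonoid.closure_le.2 fun b hb => ?_
    rcases eq_or_ne b 0 with rfl | h0
    · exact zero_mem _
    · exact AddSubmonoid.subset_closure (by simpa [h0] using hb)

lemma countUpTo_le_embDim_add (A : Set ℕ) (N : ℕ) :
    countUpTo A N ≤ embDim (gen A) + countUpTo (redundant A) N := by
  classical
  obtain ⟨B, -, hB, hcard⟩ := exists_finset_card_eq_embDim (gen A)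
  rw [← hcard, countUpTo, countUpTo]
  refine (Finset.card_le_card ?_).trans (Finset.card_union_le _ _)
  intro n hn
  simp only [Finset.mem_filter, Finset.mem_union] at hn ⊢
  by_cases h : n ∈ redundant A
  · exact Or.inr ⟨hn.1, h⟩
  · exact Or.inl (mem_of_gen_eq hB hn.2 h)

/-- If `⟨A⟩` contains everything from `K` on and `A` has a positive element `m ≤ W`, then every
generator larger than `K + W` is redundant, because subtracting `m` stays inside `⟨A⟩`. -/
lemma embDim_gen_le {A : Set ℕ} {K W m : ℕ} (hK : ∀ n, K ≤ n → n ∈ gen A) (hm : m ∈ A)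
    (hm0 : 0 < m) (hmW : m ≤ W) : embDim (gen A) ≤ countUpTo A (K + W) := by
  classical
  refine Nat.sInf_le ⟨{n ∈ Finset.Icc 1 (K + W) | n ∈ A}, fun b hb => ?_, ?_, rfl⟩
  · exact (Finset.mem_Icc.1 (Finset.mem_filter.1 hb).1).1
  have hset : (({n ∈ Finset.Icc 1 (K + W) | n ∈ A} : Finset ℕ) : Set ℕ)
      = A ∩ Set.Icc 1 (K + W) := by
    ext n; simp [and_comm, and_left_comm]
  rw [hset]
  refine le_antisymm (AddSubmonoid.closure_mono Set.inter_subset_left) fun n hn => ?_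
  induction n using Nat.strong_induction_on with
  | _ n ih =>
    rcases le_or_gt n (K + W) with h | h
    · exact mem_gen_inter_Icc hn h
    · have h1 := ih (n - m) (by omega) (hK _ (by omega))
      have h2 : m ∈ gen (A ∩ Set.Icc 1 (K + W)) :=
        AddSubmonoid.subset_closure ⟨hm, hm0, by omega⟩
      have h3 := add_mem h1 h2
      rwa [Nat.sub_add_cancel (by omega)] at h3

lemma gaps_finite {S : AddSubmonoid ℕ} (hS : IsNumericalSemigroup S) : (gaps S).Finite :=
  Set.Finite.subset hS fun _ hn => hn.2

lemma isNumericalSemigroup_of_forall_ge {S : AddSubmonoid ℕ} {K : ℕ}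
    (hK : ∀ n, K ≤ n → n ∈ S) : IsNumericalSemigroup S :=
  (Set.finite_lt_nat K).subset fun n hn => by
    by_contra h
    exact hn (hK n (not_lt.1 h))

lemma gaps_subset_of_forall_ge {S : AddSubmonoid ℕ} {K : ℕ} (hK : ∀ n, K ≤ n → n ∈ S) :
    gaps S ⊆ Finset.Ico 1 K := fun n hn => by
  simp only [Finset.coe_Ico, Set.mem_Ico]
  exact ⟨hn.1, not_le.1 fun h => hn.2 (hK n h)⟩

lemma genus_le_of_forall_ge {S : AddSubmonoid ℕ} {K : ℕ} (hK : ∀ n, K ≤ n → n ∈ S) :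
    genus S ≤ K - 1 := by
  have h := Set.ncard_le_ncard (gaps_subset_of_forall_ge hK) (Finset.finite_toSet _)
  rwa [Set.ncard_coe_finset, Nat.card_Ico] at h

lemma frobeniusNum_le_of_forall_ge {S : AddSubmonoid ℕ} {K : ℕ} (hK : ∀ n, K ≤ n → n ∈ S) :
    frobeniusNum S ≤ (K : ℤ) - 1 := by
  unfold frobeniusNum
  split_ifs with h
  · omega
  · have h1 : sSup (gaps S) ∈ gaps S := Nat.sSup_mem (Set.nonempty_iff_ne_empty.2 h)
      ((Finset.finite_toSet _).subset (gaps_subset_of_forall_ge hK)).bddAbove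
    have h2 := gaps_subset_of_forall_ge hK h1
    simp only [Finset.coe_Ico, Set.mem_Ico] at h2
    omega

lemma le_genus_add_countUpTo {S : AddSubmonoid ℕ} (hS : IsNumericalSemigroup S) (N : ℕ) :
    N ≤ genus S + countUpTo S N := by
  classical
  have h1 : {n ∈ Finset.Icc 1 N | n ∉ (S : Set ℕ)}.card ≤ genus S := by
    rw [genus, ← Set.ncard_coe_finset]
    refine Set.ncard_le_ncard (fun n hn => ?_) (gaps_finite hS)
    simp only [Finset.coe_filter, Finset.mem_Icc, Set.mem_ofPred_eq] at hn
    exact ⟨hn.1.1, hn.2⟩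
  have h2 := Finset.card_filter_add_card_filter_not (s := Finset.Icc 1 N) (· ∈ (S : Set ℕ))
  rw [Nat.card_Icc] at h2
  unfold countUpTo
  omega

lemma genus_sub_one_le_frobeniusNum {S : AddSubmonoid ℕ} (hS : IsNumericalSemigroup S) :
    (genus S : ℤ) - 1 ≤ frobeniusNum S := by
  unfold frobeniusNum
  split_ifs with h
  · simp [genus, h]
  · have h1 : gaps S ⊆ Finset.Icc 1 (sSup (gaps S)) := fun n hn => by
      simp only [Finset.coe_Icc, Set.mem_Icc]
      exact ⟨hn.1, le_csSup (gaps_finite hS).bddAbove hn⟩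
    have h2 := Set.ncard_le_ncard h1 (Finset.finite_toSet _)
    rw [Set.ncard_coe_finset, Nat.card_Icc] at h2
    unfold genus
    omega

/-! ### The random set -/

instance (p : I) : IsProbabilityMeasure (randomSet p) := by
  unfold randomSet; infer_instance

/-- The events `n ∈ A` are independent. -/
lemma iIndepFun_mem (p : I) : iIndepFun (fun (n : ℕ) (A : Set ℕ) => n ∈ A) (randomSet p) := by
  have hm : Measurable (fun q : ℕ → Prop => {n | q n}) := measurable_set_iff.2 fun n =>
    measurable_pi_apply n
  have h2 : Measurable (fun (A : Set ℕ) (n : ℕ) => n ∈ A) :=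
    measurable_pi_iff.2 fun n => measurable_set_mem n
  have hP : IsProbabilityMeasure (randomSet p) := inferInstance
  rw [randomSet, setBernoulli_eq_map] at hP ⊢
  rw [iIndepFun_iff_map_fun_eq_infinitePi_map (fun n => measurable_set_mem n),
    Measure.map_map h2 hm]
  conv_rhs =>
    enter [1, n]
    rw [Measure.map_map (measurable_set_mem n) hm]
  have h3 : ((fun (A : Set ℕ) (n : ℕ) => n ∈ A) ∘ fun q : ℕ → Prop => {n | q n}) = id := rfl
  have h4 : ∀ n, ((fun A : Set ℕ => n ∈ A) ∘ fun q : ℕ → Prop => {n | q n}) = fun q => q n :=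
    fun n => rfl
  simp_rw [h3, h4, Measure.map_id, Measure.infinitePi_map_eval]

lemma measurable_of_mem (n : ℕ) (f : Prop → ℝ) : Measurable fun A : Set ℕ => f (n ∈ A) :=
  (Measurable.of_discrete (f := f)).comp (measurable_set_mem n)

lemma integral_mem (p : I) {n : ℕ} (hn : 0 < n) (f : Prop → ℝ) :
    ∫ A, f (n ∈ A) ∂(randomSet p) = p * f True + (1 - p) * f False := by
  have hm : Measurable (fun q : ℕ → Prop => {n | q n}) := measurable_set_iff.2 fun n =>
    measurable_pi_apply n
  rw [randomSet, setBernoulli_eq_map, integral_map hm.aemeasurable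
    (measurable_of_mem n f).aestronglyMeasurable]
  change ∫ q : ℕ → Prop, f (q n) ∂_ = _
  rw [← integral_map (φ := fun q : ℕ → Prop => q n) (f := f) (measurable_pi_apply n).aemeasurable
    (Measurable.of_discrete (f := f)).aestronglyMeasurable, Measure.infinitePi_map_eval,
    integral_add_measure Integrable.of_finite Integrable.of_finite,
    integral_smul_nnreal_measure, integral_smul_nnreal_measure, integral_dirac, integral_dirac]
  simp [hn, NNReal.smul_def]

open Classical in
/-- The weight of `A` that is the product of `u n` over the elements `n ∈ s` of `A`. -/
noncomputable def weight (s : Finset ℕ) (u : ℕ → ℝ) (A : Set ℕ) : ℝ :=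
  ∏ n ∈ s, if n ∈ A then u n else 1

lemma weight_nonneg {s : Finset ℕ} {u : ℕ → ℝ} (hu : ∀ n ∈ s, 0 ≤ u n) (A : Set ℕ) :
    0 ≤ weight s u A := by
  classical
  refine Finset.prod_nonneg fun n hn => ?_
  split_ifs
  exacts [hu n hn, zero_le_one]

lemma weight_const (a : ℝ) (N : ℕ) (A : Set ℕ) :
    weight (Finset.Icc 1 N) (fun _ => a) A = a ^ countUpTo A N := by
  classical
  simp [weight, countUpTo, Finset.prod_ite]

lemma measurable_weight (s : Finset ℕ) (u : ℕ → ℝ) : Measurable (weight s u) := by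
  classical
  unfold weight
  exact Finset.measurable_fun_prod _ fun n _ => measurable_of_mem n fun q => if q then u n else 1

lemma integrable_weight (p : I) (s : Finset ℕ) (u : ℕ → ℝ) :
    Integrable (weight s u) (randomSet p) := by
  classical
  refine Integrable.of_bound (measurable_weight s u).aestronglyMeasurable
    (∏ n ∈ s, max |u n| 1) (ae_of_all _ fun A => ?_)
  rw [weight, Real.norm_eq_abs, Finset.abs_prod]
  refine Finset.prod_le_prod (fun _ _ => abs_nonneg _) fun n _ => ?_
  split_ifs <;> simp

/-- The independence of the elements of `A`, as a bound for exponential moments. -/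
lemma integral_weight_le (p : I) {s : Finset ℕ} (hs : ∀ n ∈ s, 0 < n) {u : ℕ → ℝ}
    (hu : ∀ n ∈ s, 0 ≤ u n) :
    ∫ A, weight s u A ∂(randomSet p) ≤ Real.exp (p * ∑ n ∈ s, (u n - 1)) := by
  classical
  have h1 : ∫ A, weight s u A ∂(randomSet p) = ∏ n ∈ s, (1 + p * (u n - 1)) := by
    have h := ((iIndepFun_mem p).precomp (g := ((↑) : s → ℕ)) Subtype.val_injective)
      |>.integral_fun_prod_comp (fun n => (measurable_set_mem (n : ℕ)).aemeasurable)
      (f := fun (n : s) (q : Prop) => if q then u n else 1)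
      (fun n => (Measurable.of_discrete).aestronglyMeasurable)
    have h' : ∀ A : Set ℕ, weight s u A = ∏ n : s, if (n : ℕ) ∈ A then u n else 1 := fun A =>
      (Finset.prod_coe_sort s fun n => if n ∈ A then u n else 1).symm
    simp_rw [h', h, ← Finset.prod_coe_sort s]
    refine Finset.prod_congr rfl fun n _ => ?_
    rw [integral_mem p (hs n n.2) fun q => if q then u n else 1]
    simp only [if_true, if_false]
    ring
  rw [h1, Finset.mul_sum, Real.exp_sum]
  refine Finset.prod_le_prod (fun n hn => ?_) fun n _ => ?_
  · nlinarith [hu n hn, p.2.1, p.2.2, mul_nonneg p.2.1 (hu n hn)]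
  · rw [add_comm]; exact Real.add_one_le_exp _

/-- Markov's inequality for a weight. -/
lemma measureReal_le_of_weight (p : I) {s : Finset ℕ} (hs : ∀ n ∈ s, 0 < n) {u : ℕ → ℝ}
    (hu : ∀ n ∈ s, 0 ≤ u n) {E : Set (Set ℕ)} {t : ℝ}
    (h : ∀ A ∈ E, Real.exp t ≤ weight s u A) :
    (randomSet p).real E ≤ Real.exp (p * ∑ n ∈ s, (u n - 1) - t) := by
  have h1 := mul_meas_ge_le_integral_of_nonneg (ae_of_all _ (weight_nonneg hu))
    (integrable_weight p s u) (Real.exp t)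
  have h2 : (randomSet p).real E ≤ (randomSet p).real {A | Real.exp t ≤ weight s u A} :=
    measureReal_mono h
  rw [Real.exp_sub, le_div_iff₀ (Real.exp_pos t), mul_comm]
  exact (mul_le_mul_of_nonneg_left h2 (Real.exp_pos t).le).trans
    (h1.trans (integral_weight_le p hs hu))

lemma pos_of_mem_Icc_one {N : ℕ} : ∀ n ∈ Finset.Icc 1 N, 0 < n := fun _ hn =>
  (Finset.mem_Icc.1 hn).1

/-- Chernoff's bound for the upper tail of the number of elements of `A` up to `N`. -/
lemma measureReal_countUpTo_ge_le (p : I) (N : ℕ) :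
    (randomSet p).real {A | 3 * (p : ℝ) * N ≤ (countUpTo A N : ℝ)} ≤ Real.exp (-(p * N)) := by
  refine (measureReal_le_of_weight p (s := Finset.Icc 1 N) (u := fun _ => Real.exp 1)
    (t := 3 * p * N) pos_of_mem_Icc_one (fun _ _ => (Real.exp_pos 1).le) fun A hA => ?_).trans ?_
  · rw [weight_const, ← Real.exp_nat_mul, mul_one]
    exact Real.exp_le_exp.2 hA
  · refine Real.exp_le_exp.2 ?_
    have h1 : (0 : ℝ) ≤ p * N := mul_nonneg p.2.1 (Nat.cast_nonneg N)
    have h2 := Real.exp_one_lt_d9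
    simp only [Finset.sum_const, Nat.card_Icc, nsmul_eq_mul, Nat.add_sub_cancel]
    nlinarith

/-- Chernoff's bound for the lower tail of the number of elements of `A` up to `N`. -/
lemma measureReal_countUpTo_le_le (p : I) (N : ℕ) :
    (randomSet p).real {A | (countUpTo A N : ℝ) ≤ p * N / 4} ≤ Real.exp (-(p * N / 4)) := by
  refine (measureReal_le_of_weight p (s := Finset.Icc 1 N) (u := fun _ => Real.exp (-1))
    (t := -(p * N / 4)) pos_of_mem_Icc_one (fun _ _ => (Real.exp_pos _).le) fun A hA => ?_).trans ?_
  · rw [weight_const, ← Real.exp_nat_mul]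
    refine Real.exp_le_exp.2 ?_
    have : (countUpTo A N : ℝ) ≤ p * N / 4 := hA
    linarith
  · refine Real.exp_le_exp.2 ?_
    have h1 : (0 : ℝ) ≤ p * N := mul_nonneg p.2.1 (Nat.cast_nonneg N)
    have h2 : Real.exp (-1) ≤ 1 / 2 := by
      rw [Real.exp_neg, inv_eq_one_div]
      exact one_div_le_one_div_of_le two_pos (by linarith [Real.add_one_le_exp (1 : ℝ)])
    simp only [Finset.sum_const, Nat.card_Icc, nsmul_eq_mul, Nat.add_sub_cancel]
    nlinarith

lemma measureReal_countUpTo_eq_zero_le (p : I) (N : ℕ) :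
    (randomSet p).real {A | countUpTo A N = 0} ≤ Real.exp (-(p * N)) := by
  refine (measureReal_le_of_weight p (s := Finset.Icc 1 N) (u := fun _ => 0)
    (t := 0) pos_of_mem_Icc_one (fun _ _ => le_rfl) fun A hA => ?_).trans ?_
  · rw [weight_const, show countUpTo A N = 0 from hA]
    simp
  · simp

/-! ### Measurability -/

instance : Countable (AddSubmonoid ℕ) := by
  refine Function.Surjective.countable (f := fun B : Finset ℕ => gen (B : Set ℕ)) fun S => ?_
  obtain ⟨B, -, hB, -⟩ := exists_finset_card_eq_embDim S
  exact ⟨B, hB⟩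

lemma measurableSet_mem_gen (n : ℕ) : MeasurableSet {A : Set ℕ | n ∈ gen A} := by
  have h : {A : Set ℕ | n ∈ gen A} =
      ⋃ B ∈ {B : Finset ℕ | n ∈ gen (B : Set ℕ)}, ⋂ b ∈ B, {A : Set ℕ | b ∈ A} := by
    ext A
    simp only [Set.mem_ofPred_eq, Set.mem_iUnion, Set.mem_iInter, exists_prop]
    constructor
    · intro hn
      have hfin : (A ∩ Set.Icc 1 n).Finite := (Set.finite_Icc 1 n).subset Set.inter_subset_right
      refine ⟨hfin.toFinset, ?_, fun b hb => ((hfin.mem_toFinset).1 hb).1⟩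
      rw [hfin.coe_toFinset]
      exact mem_gen_inter_Icc hn le_rfl
    · rintro ⟨B, hB, hBA⟩
      exact AddSubmonoid.closure_mono hBA hB
  rw [h]
  exact MeasurableSet.biUnion (Set.to_countable _) fun B _ =>
    Finset.measurableSet_biInter _ fun b _ => measurableSet_mem b

/-- Every event that depends on `⟨A⟩` alone is measurable, as there are only countably many
submonoids of `ℕ`. -/
lemma measurableSet_gen_mem (T : Set (AddSubmonoid ℕ)) : MeasurableSet {A : Set ℕ | gen A ∈ T} := by
  have h : {A : Set ℕ | gen A ∈ T} =
      ⋃ S ∈ T, ⋂ n, {A : Set ℕ | n ∈ gen A ↔ n ∈ S} := by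
    ext A
    simp only [Set.mem_ofPred_eq, Set.mem_iUnion, Set.mem_iInter, exists_prop]
    constructor
    · exact fun hA => ⟨gen A, hA, fun _ => Iff.rfl⟩
    · rintro ⟨S, hS, hAS⟩
      rwa [show gen A = S from AddSubmonoid.ext hAS]
  rw [h]
  refine MeasurableSet.biUnion (Set.to_countable _) fun S _ => MeasurableSet.iInter fun n => ?_
  by_cases hn : n ∈ S
  · simpa [hn] using measurableSet_mem_gen n
  · have h1 : {A : Set ℕ | n ∈ gen A ↔ n ∈ S} = {A : Set ℕ | n ∈ gen A}ᶜ := by ext; simp [hn]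
    exact h1 ▸ (measurableSet_mem_gen n).compl

lemma measurable_comp_gen (f : AddSubmonoid ℕ → ℝ) : Measurable fun A : Set ℕ => f (gen A) :=
  fun s _ => measurableSet_gen_mem (f ⁻¹' s)

lemma measurableSet_mem_gen_inter_Iio (n : ℕ) :
    MeasurableSet {A : Set ℕ | n ∈ gen (A ∩ Set.Iio n)} := by
  have hm : Measurable fun A : Set ℕ => A ∩ Set.Iio n := measurable_set_iff.2 fun k => by
    by_cases hk : k < n
    · simpa [hk] using measurable_set_mem k
    · simp [hk]
  exact hm (measurableSet_mem_gen n)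

lemma measurableSet_mem_redundant (n : ℕ) : MeasurableSet {A : Set ℕ | n ∈ redundant A} :=
  (measurableSet_mem n).inter (measurableSet_mem_gen_inter_Iio n)

lemma integrable_countUpTo (p : I) {X : Set ℕ → Set ℕ}
    (hX : ∀ n, MeasurableSet {A : Set ℕ | n ∈ X A}) (N : ℕ) :
    Integrable (fun A => (countUpTo (X A) N : ℝ)) (randomSet p) := by
  refine Integrable.of_bound (Measurable.aestronglyMeasurable ?_) N (ae_of_all _ fun A => ?_)
  · simp_rw [countUpTo_eq_sum]
    refine Finset.measurable_fun_sum _ fun n _ => ?_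
    exact (measurable_const (a := (1 : ℝ))).indicator (hX n)
  · simpa using countUpTo_le _ _

lemma integral_countUpTo (p : I) {X : Set ℕ → Set ℕ}
    (hX : ∀ n, MeasurableSet {A : Set ℕ | n ∈ X A}) (N : ℕ) :
    ∫ A, (countUpTo (X A) N : ℝ) ∂(randomSet p) =
      ∑ n ∈ Finset.Icc 1 N, (randomSet p).real {A | n ∈ X A} := by
  simp_rw [countUpTo_eq_sum]
  have h : ∀ n A, (X A).indicator (1 : ℕ → ℝ) n
      = {A : Set ℕ | n ∈ X A}.indicator (1 : Set ℕ → ℝ) A := fun n A => rfl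
  have hi : ∀ n, Integrable ({A : Set ℕ | n ∈ X A}.indicator (1 : Set ℕ → ℝ)) (randomSet p) :=
    fun n => (integrable_const (1 : ℝ)).indicator (hX n)
  simp_rw [h]
  rw [integral_finsetSum _ fun n _ => hi n]
  exact Finset.sum_congr rfl fun n _ => integral_indicator_one (hX n)

lemma measureReal_mem (p : I) {n : ℕ} (hn : 0 < n) :
    (randomSet p).real {A : Set ℕ | n ∈ A} = p := by
  classical
  rw [← integral_indicator_one (measurableSet_mem n)]
  have h := integral_mem p hn fun q => if q then 1 else 0
  simp only [if_true, if_false, mul_one, mul_zero, add_zero] at h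
  rw [← h]
  rfl

lemma integral_countUpTo_self (p : I) (N : ℕ) :
    ∫ A, (countUpTo A N : ℝ) ∂(randomSet p) = p * N := by
  rw [integral_countUpTo p (X := fun A => A) measurableSet_mem,
    Finset.sum_congr rfl fun n hn => measureReal_mem p (pos_of_mem_Icc_one n hn)]
  simp [mul_comm]

/-- Whether `n` is a sum of smaller elements of `A` does not depend on whether `n ∈ A`. -/
lemma measureReal_mem_redundant (p : I) {n : ℕ} (hn : 0 < n) :
    (randomSet p).real {A : Set ℕ | n ∈ redundant A} =
      p * (randomSet p).real {A : Set ℕ | n ∈ gen (A ∩ Set.Iio n)} := by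
  have h := (iIndepFun_mem p).indepFun_finset {n} (Finset.range n) (by simp)
    fun k => measurable_set_mem k
  let φ : (Finset.range n → Prop) → Set ℕ := fun q => {k | ∃ hk : k ∈ Finset.range n, q ⟨k, hk⟩}
  have h1 := h.measure_inter_preimage_eq_mul {q | q ⟨n, by simp⟩} {q | n ∈ gen (φ q)}
    (Set.toFinite _).measurableSet (Set.toFinite _).measurableSet
  have h2 : ∀ A : Set ℕ, φ (fun k => (k : ℕ) ∈ A) = A ∩ Set.Iio n := fun A => by
    ext k
    simp [φ, and_comm]
  rw [← measureReal_mem p hn]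
  simp only [measureReal_def, ← ENNReal.toReal_mul]
  congr 1
  simp only [Set.preimage_ofPred_eq, h2] at h1
  exact h1

lemma integral_countUpTo_redundant_le (p : I) (N : ℕ) :
    ∫ A, (countUpTo (redundant A) N : ℝ) ∂(randomSet p) ≤
      p * ∫ A, (countUpTo (gen A : Set ℕ) N : ℝ) ∂(randomSet p) := by
  rw [integral_countUpTo p measurableSet_mem_redundant,
    integral_countUpTo p (X := fun A => (gen A : Set ℕ)) measurableSet_mem_gen, Finset.mul_sum]
  refine Finset.sum_le_sum fun n hn => ?_
  rw [measureReal_mem_redundant p (pos_of_mem_Icc_one n hn)]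
  exact mul_le_mul_of_nonneg_left (measureReal_mono fun A hA => gen_inter_Iio_le hA) p.2.1

/-! ### Subset sums modulo `m` -/

lemma addChar_map_sum {ι G : Type*} [AddCommMonoid G] (ψ : AddChar G ℂ) (s : Finset ι)
    (f : ι → G) : ψ (∑ i ∈ s, f i) = ∏ i ∈ s, ψ (f i) := by
  induction s using Finset.cons_induction with
  | empty => simp
  | cons a s ha ih => rw [Finset.prod_cons, Finset.sum_cons, AddChar.map_add_eq_mul, ih]

/-- If the subset sums of `T` miss the residue `g`, then a nontrivial Fourier coefficient of the
law of a uniformly random subset sum is not small. The factors `(1 + Re ψ t) / 2` are the squared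
absolute values of the factors `(1 + ψ t) / 2` of that coefficient. -/
lemma one_le_sum_prod_of_missed {m : ℕ} [NeZero m] {T : Finset ℕ} {g : ZMod m}
    (hg : ∀ U ⊆ T, ((∑ t ∈ U, t : ℕ) : ZMod m) ≠ g) :
    1 ≤ m * ∑ ψ ∈ Finset.univ.erase (0 : AddChar (ZMod m) ℂ),
      ∏ t ∈ T, (1 + (ψ (t : ZMod m)).re) / 2 := by
  classical
  have h1 : ∑ ψ : AddChar (ZMod m) ℂ, ψ (-g) * ∏ t ∈ T, (1 + ψ (t : ZMod m)) = 0 := by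
    simp_rw [Finset.prod_one_add, Finset.mul_sum]
    rw [Finset.sum_comm]
    refine Finset.sum_eq_zero fun U hU => ?_
    have h2 : ∀ ψ : AddChar (ZMod m) ℂ, ψ (-g) * ∏ t ∈ U, ψ (t : ZMod m)
        = ψ (((∑ t ∈ U, t : ℕ) : ZMod m) - g) := fun ψ => by
      rw [sub_eq_neg_add, AddChar.map_add_eq_mul, Nat.cast_sum]
      rw [addChar_map_sum]
    simp_rw [h2]
    exact AddChar.sum_apply_eq_zero_iff_ne_zero.2
      (sub_ne_zero.2 (hg U (Finset.mem_powerset.1 hU)))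
  rw [← Finset.add_sum_erase _ _ (Finset.mem_univ (0 : AddChar (ZMod m) ℂ))] at h1
  -- the trivial character contributes `2 ^ #T`, which the others have to cancel
  simp only [AddChar.zero_apply, one_mul, Finset.prod_const] at h1
  have hnorm : ∀ (ψ : AddChar (ZMod m) ℂ) (x : ZMod m), ‖ψ x‖ = 1 := fun ψ x => by
    exact AddChar.norm_apply ψ x
  set b : AddChar (ZMod m) ℂ → ℝ := fun ψ => ∏ t ∈ T, (‖1 + ψ (t : ZMod m)‖ / 2) with hb
  have h3 : 1 ≤ ∑ ψ ∈ Finset.univ.erase (0 : AddChar (ZMod m) ℂ), b ψ := by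
    have h4 : (2 : ℝ) ^ T.card ≤ ∑ ψ ∈ Finset.univ.erase (0 : AddChar (ZMod m) ℂ),
        ∏ t ∈ T, ‖1 + ψ (t : ZMod m)‖ := by
      calc (2 : ℝ) ^ T.card = ‖((1 : ℂ) + 1) ^ T.card‖ := by norm_num
        _ = ‖∑ ψ ∈ Finset.univ.erase (0 : AddChar (ZMod m) ℂ),
              ψ (-g) * ∏ t ∈ T, (1 + ψ (t : ZMod m))‖ := by
          rw [eq_neg_of_add_eq_zero_left h1, norm_neg]
        _ ≤ _ := (norm_sum_le _ _).trans (Finset.sum_le_sum fun ψ _ => by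
          rw [norm_mul, hnorm, one_mul, norm_prod])
    simp only [hb, Finset.prod_div_distrib, Finset.prod_const, ← Finset.sum_div]
    rwa [le_div_iff₀ (by positivity), one_mul]
  have h5 : ∀ ψ : AddChar (ZMod m) ℂ, b ψ ^ 2 = ∏ t ∈ T, (1 + (ψ (t : ZMod m)).re) / 2 := by
    intro ψ
    rw [hb, ← Finset.prod_pow]
    refine Finset.prod_congr rfl fun t _ => ?_
    have h6 := hnorm ψ (t : ZMod m)
    rw [← sq_eq_sq₀ (norm_nonneg _) zero_le_one, Complex.sq_norm, Complex.normSq_apply] at h6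
    rw [div_pow, Complex.sq_norm, Complex.normSq_apply]
    simp only [Complex.add_re, Complex.add_im, Complex.one_re, Complex.one_im]
    linarith
  simp_rw [← h5]
  -- Cauchy–Schwarz over the at most `m` nontrivial characters
  calc (1 : ℝ) ≤ (∑ ψ ∈ Finset.univ.erase (0 : AddChar (ZMod m) ℂ), b ψ) ^ 2 := one_le_pow₀ h3
    _ ≤ _ := sq_sum_le_card_mul_sum_sq
    _ ≤ _ := by
      refine mul_le_mul_of_nonneg_right ?_ (Finset.sum_nonneg fun _ _ => sq_nonneg _)
      exact_mod_cast (Finset.card_le_univ _).trans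
        ((AddChar.card_eq (α := ZMod m)).trans (ZMod.card m)).le

/-- A nontrivial character sums to zero over complete residue systems. -/
lemma sum_Icc_addChar_eq_zero {m : ℕ} [NeZero m] {ψ : AddChar (ZMod m) ℂ} (hψ : ψ ≠ 0) (q : ℕ) :
    ∑ n ∈ Finset.Icc 1 (m * q), ψ (n : ZMod m) = 0 := by
  have h1 : ∀ n : ℕ, ψ (n : ZMod m) = ψ 1 ^ n := fun n => by
    rw [← AddChar.map_nsmul_eq_pow, nsmul_eq_mul, mul_one]
  have h2 : ψ 1 ≠ 1 := (AddChar.zmod_char_ne_one_iff m ψ).1 hψ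
  have h3 : ψ 1 ^ m = 1 := by rw [← h1]; simp
  have h4 : ∑ n ∈ Finset.range (m * q), ψ 1 ^ n = 0 := by
    rw [geom_sum_eq h2, pow_mul, h3, one_pow, sub_self, zero_div]
  simp_rw [h1]
  rw [← Finset.Ico_add_one_right_eq_Icc, Finset.sum_Ico_eq_sum_range]
  simp only [Nat.add_sub_cancel, pow_add, pow_one, ← Finset.mul_sum, h4, mul_zero]

open Classical in
/-- Some residue modulo `m` is not the sum of distinct elements of `A ∩ {1, …, N}`. -/
def MissesResidue (m N : ℕ) (A : Set ℕ) : Prop :=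
  ∃ g : ZMod m, ∀ U ⊆ {n ∈ Finset.Icc 1 N | n ∈ A}, ((∑ t ∈ U, t : ℕ) : ZMod m) ≠ g

lemma measureReal_missesResidue_le (p : I) {m : ℕ} (hm : 0 < m) (q : ℕ) :
    (randomSet p).real {A | MissesResidue m (m * q) A} ≤
      m ^ 2 * Real.exp (-(p * (m * q : ℕ) / 2)) := by
  classical
  have : NeZero m := ⟨hm.ne'⟩
  let v : AddChar (ZMod m) ℂ → ℕ → ℝ := fun ψ n => (1 + (ψ (n : ZMod m)).re) / 2
  let Y : Set ℕ → ℝ := fun A => m * ∑ ψ ∈ Finset.univ.erase (0 : AddChar (ZMod m) ℂ),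
    weight (Finset.Icc 1 (m * q)) (v ψ) A
  have hv : ∀ ψ n, 0 ≤ v ψ n := fun ψ n => by
    have h1 := (abs_le.1 (Complex.abs_re_le_norm (ψ (n : ZMod m)))).1
    rw [AddChar.norm_apply] at h1
    simp only [v]
    linarith
  have hY : ∀ A, 0 ≤ Y A := fun A => mul_nonneg (Nat.cast_nonneg m)
    (Finset.sum_nonneg fun ψ _ => weight_nonneg (fun n _ => hv ψ n) A)
  have hint : ∀ ψ, Integrable (weight (Finset.Icc 1 (m * q)) (v ψ)) (randomSet p) :=
    fun ψ => integrable_weight _ _ _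
  have hYint : Integrable Y (randomSet p) :=
    (integrable_finsetSum _ fun ψ _ => hint ψ).const_mul _
  have h1 := mul_meas_ge_le_integral_of_nonneg (ae_of_all _ hY) hYint 1
  rw [one_mul] at h1
  have h2 : {A | MissesResidue m (m * q) A} ⊆ {A | 1 ≤ Y A} := by
    rintro A ⟨g, hg⟩
    have h3 := one_le_sum_prod_of_missed hg
    change 1 ≤ Y A
    simp only [Finset.prod_filter] at h3
    simp only [Y, weight, v]
    convert h3
  refine (measureReal_mono h2).trans (h1.trans ?_)
  simp only [Y]
  rw [integral_const_mul, integral_finsetSum _ fun ψ _ => hint ψ, sq, mul_assoc]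
  refine mul_le_mul_of_nonneg_left ?_ (Nat.cast_nonneg m)
  have h4 : ∀ ψ ∈ Finset.univ.erase (0 : AddChar (ZMod m) ℂ),
      ∫ A, weight (Finset.Icc 1 (m * q)) (v ψ) A ∂(randomSet p) ≤
        Real.exp (-(p * (m * q : ℕ) / 2)) := by
    intro ψ hψ
    refine (integral_weight_le p pos_of_mem_Icc_one fun n _ => hv ψ n).trans (le_of_eq ?_)
    congr 1
    have h5 := congrArg Complex.re (sum_Icc_addChar_eq_zero (Finset.ne_of_mem_erase hψ) q)
    rw [Complex.re_sum, Complex.zero_re] at h5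
    have h6 : ∑ n ∈ Finset.Icc 1 (m * q), (v ψ n - 1)
        = (∑ n ∈ Finset.Icc 1 (m * q), (ψ (n : ZMod m)).re) / 2 - (m * q : ℕ) / 2 := by
      have h7 : ∀ n, v ψ n - 1 = (ψ (n : ZMod m)).re / 2 - 1 / 2 := fun n => by
        simp only [v]; ring
      simp_rw [h7]
      rw [Finset.sum_sub_distrib, Finset.sum_div]
      simp
      ring
    rw [h6, h5]
    ring
  refine (Finset.sum_le_card_nsmul _ _ _ h4).trans ?_
  rw [nsmul_eq_mul]
  refine mul_le_mul_of_nonneg_right ?_ (Real.exp_pos _).le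
  exact_mod_cast (Finset.card_le_univ _).trans
    ((AddChar.card_eq (α := ZMod m)).trans (ZMod.card m)).le

/-! ### The Frobenius number is small -/

/-- The window `{1, …, W}` meets `A`, and `⟨A⟩` contains every integer from `3 p W ^ 2` on. -/
def GoodWindow (p : I) (W : ℕ) (A : Set ℕ) : Prop :=
  (∀ n : ℕ, 3 * (p : ℝ) * W ^ 2 ≤ n → n ∈ gen A) ∧ ∃ m ∈ A, 0 < m ∧ m ≤ W

lemma measurableSet_goodWindow (p : I) (W : ℕ) : MeasurableSet {A | GoodWindow p W A} := by
  have h : {A : Set ℕ | ∃ m ∈ A, 0 < m ∧ m ≤ W} =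
      ⋃ m ∈ {m : ℕ | 0 < m ∧ m ≤ W}, {A : Set ℕ | m ∈ A} := by
    ext A; simp [and_comm]
  have h' : MeasurableSet {A : Set ℕ | ∃ m ∈ A, 0 < m ∧ m ≤ W} :=
    h ▸ MeasurableSet.biUnion (Set.to_countable _) fun m _ => measurableSet_mem m
  exact (measurableSet_gen_mem {S | ∀ n : ℕ, 3 * (p : ℝ) * W ^ 2 ≤ n → n ∈ S}).inter h'

/-- If `m ∈ A` and every residue modulo `m` is a sum of distinct elements of `A ∩ {1, …, W}`, then
every `n` that is at least as large as all these sums is such a sum plus a multiple of `m`. -/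
lemma goodWindow_of (p : I) {W : ℕ} {A : Set ℕ} (h0 : countUpTo A W ≠ 0)
    (h1 : (countUpTo A W : ℝ) < 3 * p * W)
    (h2 : ∀ m ∈ Finset.Icc 1 W, ¬ MissesResidue m (m * (W / m)) A) : GoodWindow p W A := by
  classical
  obtain ⟨m, hm⟩ := Finset.card_ne_zero.1 h0
  rw [Finset.mem_filter] at hm
  obtain ⟨hmW, hmA⟩ := hm
  refine ⟨fun n hn => ?_, m, hmA, Finset.mem_Icc.1 hmW⟩
  have h3 := h2 m hmW
  simp only [MissesResidue, not_exists, not_forall, not_not, exists_prop] at h3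
  obtain ⟨U, hU, hUn⟩ := h3 n
  have hUA : ∀ t ∈ U, t ∈ A ∧ 1 ≤ t ∧ t ≤ W := fun t ht => by
    have h4 := Finset.mem_filter.1 (hU ht)
    have h5 := Finset.mem_Icc.1 h4.1
    exact ⟨h4.2, h5.1, h5.2.trans (Nat.mul_div_le W m)⟩
  have hcard : U.card ≤ countUpTo A W := Finset.card_le_card fun t ht => by
    have := hUA t ht
    simp [this]
  have hsum : ∑ t ∈ U, t ≤ countUpTo A W * W :=
    (Finset.sum_le_card_nsmul _ _ W fun t ht => (hUA t ht).2.2).trans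
      (Nat.mul_le_mul_right W hcard)
  have hle : ∑ t ∈ U, t ≤ n := by
    have h6 : (countUpTo A W : ℝ) * W ≤ n :=
      (mul_le_mul_of_nonneg_right h1.le (Nat.cast_nonneg W)).trans
        (by rw [mul_assoc, ← sq]; exact hn)
    exact hsum.trans (by exact_mod_cast h6)
  have hdvd : m ∣ n - ∑ t ∈ U, t :=
    (Nat.modEq_iff_dvd' hle).1 ((ZMod.natCast_eq_natCast_iff _ _ _).1 hUn)
  obtain ⟨k, hk⟩ := hdvd
  have hn' : n = ∑ t ∈ U, t + k • m := by rw [smul_eq_mul, mul_comm k m]; omega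
  rw [hn']
  exact add_mem (sum_mem fun t ht => AddSubmonoid.subset_closure (hUA t ht).1)
    (nsmul_mem (AddSubmonoid.subset_closure hmA) k)

lemma measureReal_not_goodWindow_le (p : I) {W : ℕ} (hW : 1 ≤ W) :
    (randomSet p).real {A | ¬ GoodWindow p W A} ≤ 3 * W ^ 3 * Real.exp (-(p * W / 4)) := by
  have hsub : {A | ¬ GoodWindow p W A} ⊆ ({A | countUpTo A W = 0} ∪
      {A | 3 * (p : ℝ) * W ≤ (countUpTo A W : ℝ)}) ∪
      ⋃ m ∈ Finset.Icc 1 W, {A | MissesResidue m (m * (W / m)) A} := by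
    intro A hA
    by_contra h
    simp only [Set.mem_union, Set.mem_ofPred_eq, Set.mem_iUnion, not_or, not_exists, not_le] at h
    exact hA (goodWindow_of p h.1.1 h.1.2 h.2)
  have hp : (0 : ℝ) ≤ p := p.2.1
  have hWr : (1 : ℝ) ≤ W := by exact_mod_cast hW
  have hpW : (0 : ℝ) ≤ p * W := by positivity
  have h1 : ∀ m ∈ Finset.Icc 1 W, (randomSet p).real {A | MissesResidue m (m * (W / m)) A} ≤
      W ^ 2 * Real.exp (-(p * W / 4)) := by
    intro m hm
    obtain ⟨hm1, hmW⟩ := Finset.mem_Icc.1 hm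
    refine (measureReal_missesResidue_le p hm1 (W / m)).trans ?_
    -- rounding `W` down to a multiple of `m ≤ W` loses at most half of the window
    have h2 : W ≤ 2 * (m * (W / m)) := by
      have h3 := Nat.div_add_mod W m
      have h4 := Nat.mod_lt W hm1
      have h5 : m * 1 ≤ m * (W / m) := Nat.mul_le_mul_left m (Nat.div_pos hmW hm1)
      omega
    have h2' : (W : ℝ) ≤ 2 * (m * (W / m) : ℕ) := by exact_mod_cast h2
    have hmW' : (m : ℝ) ≤ W := by exact_mod_cast hmW
    refine mul_le_mul (by gcongr) (Real.exp_le_exp.2 ?_) (Real.exp_pos _).le (by positivity)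
    nlinarith
  have h2 : (randomSet p).real (⋃ m ∈ Finset.Icc 1 W, {A | MissesResidue m (m * (W / m)) A}) ≤
      W ^ 3 * Real.exp (-(p * W / 4)) := by
    refine (measureReal_biUnion_finset_le _ _).trans ((Finset.sum_le_card_nsmul _ _ _ h1).trans ?_)
    rw [Nat.card_Icc, Nat.add_sub_cancel, nsmul_eq_mul]
    exact le_of_eq (by ring)
  have h3 : Real.exp (-(p * W)) ≤ Real.exp (-(p * W / 4)) := Real.exp_le_exp.2 (by linarith)
  have h4 := (measureReal_mono (μ := randomSet p) hsub).trans
    ((measureReal_union_le _ _).trans (add_le_add (measureReal_union_le _ _) le_rfl))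
  have h5 := measureReal_countUpTo_eq_zero_le p W
  have h6 := measureReal_countUpTo_ge_le p W
  have h7 : 1 * Real.exp (-(p * W / 4)) ≤ (W : ℝ) ^ 3 * Real.exp (-(p * W / 4)) :=
    mul_le_mul_of_nonneg_right (one_le_pow₀ hWr) (Real.exp_pos _).le
  linarith

/-! ### `⟨A⟩` is sparse -/

open Classical in
/-- The generating function of `⟨B⟩` is dominated by that of the representations as sums of
elements of `B`, which is the product `∏ (1 - x ^ b)⁻¹`. -/
lemma sum_pow_gen_le {x : ℝ} (hx0 : 0 ≤ x) (hx1 : x < 1) (N : ℕ) (B : Finset ℕ)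
    (hB : ∀ b ∈ B, 0 < b) :
    ∑ n ∈ Finset.range (N + 1) with n ∈ gen (B : Set ℕ), x ^ n ≤ ∏ b ∈ B, (1 - x ^ b)⁻¹ := by
  induction B using Finset.cons_induction with
  | empty =>
    have h : {n ∈ Finset.range (N + 1) | n ∈ gen ((∅ : Finset ℕ) : Set ℕ)} ⊆ {0} := by
      intro n hn
      simpa using (Finset.mem_filter.1 hn).2
    refine (Finset.sum_le_sum_of_subset_of_nonneg h fun n _ _ => pow_nonneg hx0 n).trans ?_
    simp
  | cons b s hb ih =>
    have hb0 : 0 < b := hB b (Finset.mem_cons_self b s)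
    have hxb : x ^ b < 1 := pow_lt_one₀ hx0 hx1 hb0.ne'
    have ih' := ih fun c hc => hB c (Finset.mem_cons_of_mem hc)
    have hsub : {n ∈ Finset.range (N + 1) | n ∈ gen ((Finset.cons b s hb : Finset ℕ) : Set ℕ)} ⊆
        (Finset.range (N + 1) ×ˢ {n ∈ Finset.range (N + 1) | n ∈ gen (s : Set ℕ)}).image
          fun q => b * q.1 + q.2 := by
      intro n hn
      obtain ⟨hnN, hn⟩ := Finset.mem_filter.1 hn
      rw [Finset.coe_cons, Set.insert_eq, gen, AddSubmonoid.closure_union, AddSubmonoid.mem_sup] at hn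
      obtain ⟨y, hy, z, hz, rfl⟩ := hn
      obtain ⟨k, rfl⟩ := AddSubmonoid.mem_closure_singleton.1 hy
      rw [smul_eq_mul] at hnN
      rw [Finset.mem_range] at hnN
      have hk : k * 1 ≤ k * b := Nat.mul_le_mul_left k hb0
      refine Finset.mem_image.2 ⟨(k, z), ?_, by simp [mul_comm]⟩
      simp only [Finset.mem_product, Finset.mem_filter, Finset.mem_range]
      exact ⟨by omega, by omega, hz⟩
    calc _ ≤ ∑ n ∈ (Finset.range (N + 1) ×ˢ
            {n ∈ Finset.range (N + 1) | n ∈ gen (s : Set ℕ)}).image (fun q => b * q.1 + q.2),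
            x ^ n := Finset.sum_le_sum_of_subset_of_nonneg hsub fun n _ _ => pow_nonneg hx0 n
      _ ≤ ∑ q ∈ Finset.range (N + 1) ×ˢ {n ∈ Finset.range (N + 1) | n ∈ gen (s : Set ℕ)},
            x ^ (b * q.1 + q.2) :=
          Finset.sum_image_le_of_nonneg fun q _ => pow_nonneg hx0 _
      _ = (∑ k ∈ Finset.range (N + 1), (x ^ b) ^ k) *
            ∑ n ∈ Finset.range (N + 1) with n ∈ gen (s : Set ℕ), x ^ n := by
          rw [Finset.sum_product, Finset.sum_mul_sum]
          simp_rw [pow_add, pow_mul]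
      _ ≤ (1 - x ^ b)⁻¹ * ∏ c ∈ s, (1 - x ^ c)⁻¹ := by
          refine mul_le_mul ?_ ih' (Finset.sum_nonneg fun n _ => pow_nonneg hx0 n)
            (inv_nonneg.2 (by linarith))
          rw [← tsum_geometric_of_lt_one (pow_nonneg hx0 b) hxb]
          exact (summable_geometric_of_lt_one (pow_nonneg hx0 b) hxb).sum_le_tsum _
            fun k _ => pow_nonneg (pow_nonneg hx0 b) k
      _ = _ := by rw [Finset.prod_cons]

lemma pow_mul_countUpTo_gen_le {x : ℝ} (hx0 : 0 ≤ x) (hx1 : x < 1) (N : ℕ) (A : Set ℕ) :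
    x ^ N * countUpTo (gen A) N ≤ weight (Finset.Icc 1 N) (fun n => (1 - x ^ n)⁻¹) A := by
  classical
  have h := sum_pow_gen_le hx0 hx1 N {n ∈ Finset.Icc 1 N | n ∈ A} fun b hb =>
    pos_of_mem_Icc_one b (Finset.mem_filter.1 hb).1
  rw [weight, ← Finset.prod_filter]
  refine le_trans ?_ h
  rw [countUpTo, mul_comm, ← nsmul_eq_mul]
  refine (Finset.card_nsmul_le_sum _ (fun n => x ^ n) _ fun n hn => ?_).trans
    (Finset.sum_le_sum_of_subset_of_nonneg (fun n hn => ?_) fun n _ _ => pow_nonneg hx0 n)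
  · exact pow_le_pow_of_le_one hx0 hx1.le (Finset.mem_Icc.1 (Finset.mem_filter.1 hn).1).2
  · obtain ⟨hn1, hn2⟩ := Finset.mem_filter.1 hn
    have hnN := (Finset.mem_Icc.1 hn1).2
    refine Finset.mem_filter.2 ⟨Finset.mem_range.2 (by omega), ?_⟩
    refine AddSubmonoid.closure_mono ?_ (mem_gen_inter_Icc hn2 hnN)
    intro k hk
    simpa [and_comm, and_left_comm] using hk

/-- The exponent of the half moment of `∏ (1 - x ^ a)⁻¹`. With `s n = √(1 - x ^ n)` one has
`1 / s n - 1 ≤ x ^ n / s n ≤ 2 / (1 - x) * (s n - s (n - 1))`, and the bound telescopes. (The sum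
of `(1 - x ^ n)⁻¹ - 1` would be larger by a logarithm, so the first moment does not suffice.) -/
lemma sum_inv_sqrt_sub_one_le {x : ℝ} (hx0 : 0 ≤ x) (hx1 : x < 1) (N : ℕ) :
    ∑ n ∈ Finset.Icc 1 N, ((√(1 - x ^ n))⁻¹ - 1) ≤ 2 / (1 - x) := by
  set s : ℕ → ℝ := fun n => √(1 - x ^ n) with hs
  have h1x : 0 < 1 - x := by linarith
  have hpow : ∀ n : ℕ, x ^ n ≤ 1 := fun n => pow_le_one₀ hx0 hx1.le
  have hsq : ∀ n, s n ^ 2 = 1 - x ^ n := fun n => Real.sq_sqrt (by linarith [hpow n])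
  have hs0 : ∀ n, 0 ≤ s n := fun n => Real.sqrt_nonneg _
  have hs1 : ∀ n, s n ≤ 1 := fun n => by
    rw [← Real.sqrt_one]
    exact Real.sqrt_le_sqrt (by linarith [pow_nonneg hx0 n])
  have hmono : ∀ n, s n ≤ s (n + 1) := fun n =>
    Real.sqrt_le_sqrt (by linarith [pow_le_pow_of_le_one hx0 hx1.le (Nat.le_add_right n 1)])
  have hstep : ∀ n, (s (n + 1))⁻¹ - 1 ≤ 2 / (1 - x) * (s (n + 1) - s n) := by
    intro n
    have hpos : 0 < s (n + 1) := Real.sqrt_pos.2 (by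
      linarith [pow_lt_one₀ hx0 hx1 (by omega : n + 1 ≠ 0)])
    have e1 := hsq n
    have e2 := hsq (n + 1)
    have e3 : x ^ (n + 1) ≤ x ^ n := pow_le_pow_of_le_one hx0 hx1.le (Nat.le_add_right n 1)
    have e4 : x ^ (n + 1) * (1 - x) ≤ 2 * (s (n + 1) - s n) * s (n + 1) := by
      have e5 : x ^ (n + 1) * (1 - x) ≤ x ^ n * (1 - x) := mul_le_mul_of_nonneg_right e3 h1x.le
      have e6 : x ^ n * (1 - x) = s (n + 1) ^ 2 - s n ^ 2 := by rw [e1, e2]; ring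
      nlinarith [hmono n]
    have e7 : (s (n + 1))⁻¹ - 1 ≤ x ^ (n + 1) / s (n + 1) := by
      rw [show x ^ (n + 1) = 1 - s (n + 1) ^ 2 by linarith, inv_eq_one_div, sub_le_iff_le_add,
        div_add_one hpos.ne', div_le_div_iff_of_pos_right hpos]
      nlinarith [hs1 (n + 1)]
    refine e7.trans ?_
    rw [div_le_iff₀ hpos, div_mul_eq_mul_div, div_mul_eq_mul_div, le_div_iff₀ h1x]
    exact e4
  rw [← Finset.Ico_add_one_right_eq_Icc, Finset.sum_Ico_eq_sum_range, Nat.add_sub_cancel]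
  calc ∑ i ∈ Finset.range N, ((s (1 + i))⁻¹ - 1)
      ≤ ∑ i ∈ Finset.range N, 2 / (1 - x) * (s (i + 1) - s i) :=
        Finset.sum_le_sum fun i _ => by rw [add_comm 1 i]; exact hstep i
    _ = 2 / (1 - x) * (s N - s 0) := by rw [← Finset.mul_sum, Finset.sum_range_sub]
    _ ≤ 2 / (1 - x) * 1 := by
        refine mul_le_mul_of_nonneg_left ?_ (by positivity)
        linarith [hs1 N, hs0 0]
    _ = _ := mul_one _

/-- The expected number of elements of `⟨A⟩` in `{1, …, N}`, through the half moment of the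
generating function at `x = exp (-1 / M)`. -/
lemma integral_countUpTo_gen_le (p : I) (N : ℕ) {M : ℝ} (hM : 1 ≤ M) :
    ∫ A, (countUpTo (gen A : Set ℕ) N : ℝ) ∂(randomSet p) ≤
      √N * Real.exp (N / (2 * M) + 4 * p * M) := by
  have hM0 : 0 < M := by linarith
  set x : ℝ := Real.exp (-(1 / M)) with hx
  have hx0 : 0 < x := Real.exp_pos _
  have hx1 : x < 1 := Real.exp_lt_one_iff.2 (by simpa using hM0)
  have hgap : 1 / (2 * M) ≤ 1 - x := by
    have h1 : x ≤ 1 / (1 + 1 / M) := by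
      rw [hx, Real.exp_neg, inv_eq_one_div]
      exact one_div_le_one_div_of_le (by positivity) (by linarith [Real.add_one_le_exp (1 / M)])
    have h2 : 1 / (1 + 1 / M) = 1 - 1 / (M + 1) := by field_simp; ring
    have h3 : 1 / (2 * M) ≤ 1 / (M + 1) := one_div_le_one_div_of_le (by linarith) (by linarith)
    linarith
  have hu : ∀ n ∈ Finset.Icc 1 N, 0 ≤ (√(1 - x ^ n))⁻¹ := fun n _ =>
    inv_nonneg.2 (Real.sqrt_nonneg _)
  have hpt : ∀ A, (countUpTo (gen A : Set ℕ) N : ℝ) ≤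
      √N * Real.exp (N / (2 * M)) * weight (Finset.Icc 1 N) (fun n => (√(1 - x ^ n))⁻¹) A := by
    intro A
    set Z : ℝ := (countUpTo (gen A : Set ℕ) N : ℝ) with hZ
    have hZ0 : 0 ≤ Z := Nat.cast_nonneg _
    have hw := weight_nonneg hu A
    have h1 : weight (Finset.Icc 1 N) (fun n => (1 - x ^ n)⁻¹) A =
        weight (Finset.Icc 1 N) (fun n => (√(1 - x ^ n))⁻¹) A ^ 2 := by
      classical
      rw [weight, weight, ← Finset.prod_pow]
      refine Finset.prod_congr rfl fun n _ => ?_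
      split_ifs
      · rw [inv_pow, Real.sq_sqrt (by linarith [pow_le_one₀ (n := n) hx0.le hx1.le])]
      · simp
    have h2 := pow_mul_countUpTo_gen_le hx0.le hx1 N A
    rw [h1] at h2
    have h3 : x ^ N = (Real.exp (N / (2 * M)) ^ 2)⁻¹ := by
      rw [hx, ← Real.exp_nat_mul, ← Real.exp_nat_mul, ← Real.exp_neg]
      congr 1
      push_cast
      field_simp
    have h4 : Z ≤ (Real.exp (N / (2 * M)) *
        weight (Finset.Icc 1 N) (fun n => (√(1 - x ^ n))⁻¹) A) ^ 2 := by
      rw [h3, inv_mul_le_iff₀ (by positivity)] at h2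
      rwa [mul_pow]
    have h5 : √Z ≤ Real.exp (N / (2 * M)) *
        weight (Finset.Icc 1 N) (fun n => (√(1 - x ^ n))⁻¹) A :=
      Real.sqrt_le_iff.2 ⟨mul_nonneg (Real.exp_pos _).le hw, h4⟩
    have h6 : √Z ≤ √N := Real.sqrt_le_sqrt (Nat.cast_le.2 (countUpTo_le _ _))
    -- one factor `√Z` is bounded trivially, the other by the generating function
    calc Z = √Z * √Z := (Real.mul_self_sqrt hZ0).symm
      _ ≤ √N * (Real.exp (N / (2 * M)) *
            weight (Finset.Icc 1 N) (fun n => (√(1 - x ^ n))⁻¹) A) :=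
          mul_le_mul h6 h5 (Real.sqrt_nonneg _) (Real.sqrt_nonneg _)
      _ = _ := by ring
  refine (integral_mono (integrable_countUpTo p (X := fun A => (gen A : Set ℕ))
    measurableSet_mem_gen N) ((integrable_weight p _ _).const_mul _) hpt).trans ?_
  rw [integral_const_mul, Real.exp_add, mul_assoc, mul_assoc]
  refine mul_le_mul_of_nonneg_left (mul_le_mul_of_nonneg_left ?_ (Real.exp_pos _).le)
    (Real.sqrt_nonneg _)
  refine (integral_weight_le p pos_of_mem_Icc_one hu).trans (Real.exp_le_exp.2 ?_)
  have h7 := sum_inv_sqrt_sub_one_le hx0.le hx1 N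
  have h8 : 2 / (1 - x) ≤ 4 * M := by
    rw [div_le_iff₀ (by linarith)]
    have h9 := mul_le_mul_of_nonneg_left hgap (by linarith : (0 : ℝ) ≤ 4 * M)
    have h10 : 4 * M * (1 / (2 * M)) = 2 := by field_simp; norm_num
    linarith
  have h11 := mul_le_mul_of_nonneg_left (h7.trans h8) p.2.1
  linarith

/-! ### Tails and expectations -/

lemma GoodWindow.mem_gen {p : I} {W : ℕ} {A : Set ℕ} (h : GoodWindow p W A) :
    ∀ n, ⌈3 * (p : ℝ) * W ^ 2⌉₊ ≤ n → n ∈ gen A := fun n hn => h.1 n (Nat.ceil_le.1 hn)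

lemma GoodWindow.isNumericalSemigroup {p : I} {W : ℕ} {A : Set ℕ} (h : GoodWindow p W A) :
    IsNumericalSemigroup (gen A) := isNumericalSemigroup_of_forall_ge h.mem_gen

lemma three_mul_sq_nonneg (p : I) (W : ℕ) : 0 ≤ 3 * (p : ℝ) * W ^ 2 :=
  mul_nonneg (mul_nonneg (by norm_num) p.2.1) (sq_nonneg _)

lemma GoodWindow.genus_le {p : I} {W : ℕ} {A : Set ℕ} (h : GoodWindow p W A) :
    (genus (gen A) : ℝ) ≤ 3 * p * W ^ 2 := by
  have h1 := genus_le_of_forall_ge h.mem_gen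
  have h2 := Nat.ceil_lt_add_one (three_mul_sq_nonneg p W)
  rcases Nat.eq_zero_or_pos ⌈3 * (p : ℝ) * W ^ 2⌉₊ with h0 | h0
  · rw [h0] at h1
    have h3 : genus (gen A) = 0 := by omega
    rw [h3]
    exact_mod_cast three_mul_sq_nonneg p W
  · have h3 : genus (gen A) + 1 ≤ ⌈3 * (p : ℝ) * W ^ 2⌉₊ := by omega
    have h4 : (genus (gen A) : ℝ) + 1 ≤ ⌈3 * (p : ℝ) * W ^ 2⌉₊ := by exact_mod_cast h3
    linarith

lemma GoodWindow.frobeniusNum_le {p : I} {W : ℕ} {A : Set ℕ} (h : GoodWindow p W A) :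
    (frobeniusNum (gen A) : ℝ) ≤ 3 * p * W ^ 2 := by
  have h1 := frobeniusNum_le_of_forall_ge h.mem_gen
  have h2 := Nat.ceil_lt_add_one (three_mul_sq_nonneg p W)
  have h3 : (frobeniusNum (gen A) : ℝ) ≤ ⌈3 * (p : ℝ) * W ^ 2⌉₊ - 1 := by exact_mod_cast h1
  linarith

lemma GoodWindow.embDim_le {p : I} {W : ℕ} {A : Set ℕ} (h : GoodWindow p W A) :
    embDim (gen A) ≤ countUpTo A (⌈3 * (p : ℝ) * W ^ 2⌉₊ + W) := by
  obtain ⟨m, hm, hm0, hmW⟩ := h.2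
  exact embDim_gen_le h.mem_gen hm hm0 hmW

lemma three_mul_sq_le (p : I) (W : ℕ) : 3 * (p : ℝ) * W ^ 2 ≤ 5 * W ^ 2 :=
  mul_le_mul_of_nonneg_right (by linarith [p.2.2]) (sq_nonneg _)

lemma GoodWindow.embDim_le_sq {p : I} {W : ℕ} {A : Set ℕ} (hW : 1 ≤ W) (h : GoodWindow p W A) :
    (embDim (gen A) : ℝ) ≤ 5 * W ^ 2 := by
  have h1 : (embDim (gen A) : ℝ) ≤ (⌈3 * (p : ℝ) * W ^ 2⌉₊ + W : ℕ) := by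
    exact_mod_cast h.embDim_le.trans (countUpTo_le _ _)
  have h2 := Nat.ceil_lt_add_one (three_mul_sq_nonneg p W)
  have h3 : (1 : ℝ) ≤ W := by exact_mod_cast hW
  have h4 : 3 * (p : ℝ) * W ^ 2 ≤ 3 * W ^ 2 :=
    mul_le_mul_of_nonneg_right (by linarith [p.2.2]) (sq_nonneg _)
  push_cast at h1
  nlinarith

/-- The probability that the window `W` fails decays fast enough to absorb the trivial bound
`5 (W + 1) ^ 2` for all three invariants on the next window. Half of the exponent `p W / 4` pays
for the powers of `W`, through `y ^ 5 ≤ 5! * exp y` at `y = p W / 8`; the constant is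
`60 * 8 ^ 5 * 5!`. -/
lemma sq_mul_measureReal_not_goodWindow_le {p : I} (hp : 0 < p) {W : ℕ} (hW : 1 ≤ W) :
    5 * ((W : ℝ) + 1) ^ 2 * (randomSet p).real {A | ¬ GoodWindow p W A} ≤
      235929600 * (p : ℝ)⁻¹ ^ 5 * Real.exp (-(p * W / 8)) := by
  have hp0 : (0 : ℝ) < p := hp
  have hWr : (1 : ℝ) ≤ W := by exact_mod_cast hW
  have h1 := measureReal_not_goodWindow_le p hW
  have h2 : (p * W / 8 : ℝ) ^ 5 ≤ 120 * Real.exp (p * W / 8) := by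
    have h3 := Real.pow_div_factorial_le_exp (p * W / 8 : ℝ) (by positivity) 5
    rw [div_le_iff₀ (by positivity)] at h3
    have h4 : ((Nat.factorial 5 : ℕ) : ℝ) = 120 := by norm_num [Nat.factorial]
    rw [h4] at h3
    linarith
  have h5 : (W : ℝ) ^ 5 = 32768 * (p : ℝ)⁻¹ ^ 5 * (p * W / 8) ^ 5 := by
    field_simp
    norm_num
  have h6 : Real.exp (-(p * W / 4)) = Real.exp (-(p * W / 8)) * Real.exp (-(p * W / 8)) := by
    rw [← Real.exp_add]; ring_nf
  have h7 : Real.exp (p * W / 8) * Real.exp (-(p * W / 8)) = 1 := by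
    rw [← Real.exp_add, add_neg_cancel, Real.exp_zero]
  have h8 : 5 * ((W : ℝ) + 1) ^ 2 ≤ 20 * W ^ 2 := by nlinarith
  calc 5 * ((W : ℝ) + 1) ^ 2 * (randomSet p).real {A | ¬ GoodWindow p W A}
      ≤ 20 * W ^ 2 * (3 * W ^ 3 * Real.exp (-(p * W / 4))) :=
        mul_le_mul h8 h1 measureReal_nonneg (by positivity)
    _ = 60 * W ^ 5 * Real.exp (-(p * W / 4)) := by ring
    _ = 1966080 * (p : ℝ)⁻¹ ^ 5 * (p * W / 8) ^ 5 *
          (Real.exp (-(p * W / 8)) * Real.exp (-(p * W / 8))) := by rw [h5, h6]; ring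
    _ ≤ 1966080 * (p : ℝ)⁻¹ ^ 5 * (120 * Real.exp (p * W / 8)) *
          (Real.exp (-(p * W / 8)) * Real.exp (-(p * W / 8))) := by gcongr
    _ = 235929600 * (p : ℝ)⁻¹ ^ 5 * (Real.exp (p * W / 8) * Real.exp (-(p * W / 8))) *
          Real.exp (-(p * W / 8)) := by ring
    _ = _ := by rw [h7, mul_one]

lemma measureReal_not_goodWindow_le' {p : I} (hp : 0 < p) {W : ℕ} (hW : 1 ≤ W) :
    (randomSet p).real {A | ¬ GoodWindow p W A} ≤
      235929600 * (p : ℝ)⁻¹ ^ 5 * Real.exp (-(p * W / 8)) := by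
  refine le_trans ?_ (sq_mul_measureReal_not_goodWindow_le hp hW)
  refine le_mul_of_one_le_left measureReal_nonneg ?_
  have : (0 : ℝ) ≤ W := Nat.cast_nonneg W
  nlinarith

lemma ae_exists_goodWindow {p : I} (hp : 0 < p) (W₀ : ℕ) :
    ∀ᵐ A ∂(randomSet p), ∃ W, W₀ ≤ W ∧ GoodWindow p W A := by
  have hp0 : (0 : ℝ) < p := hp
  rw [ae_iff]
  have hlim : Tendsto (fun W : ℕ => 235929600 * (p : ℝ)⁻¹ ^ 5 * Real.exp (-(p * W / 8))) atTop
      (𝓝 0) := by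
    rw [← mul_zero (235929600 * (p : ℝ)⁻¹ ^ 5)]
    refine Tendsto.const_mul _ (Real.tendsto_exp_neg_atTop_nhds_zero.comp ?_)
    exact (tendsto_natCast_atTop_atTop.const_mul_atTop hp0).atTop_div_const (by norm_num)
  have h : (randomSet p).real {A | ¬ ∃ W, W₀ ≤ W ∧ GoodWindow p W A} ≤ 0 := by
    refine ge_of_tendsto hlim ?_
    filter_upwards [eventually_ge_atTop (max W₀ 1)] with W hW
    refine (measureReal_mono fun A hA => ?_).trans
      (measureReal_not_goodWindow_le' hp ((le_max_right _ _).trans hW))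
    exact fun hg => hA ⟨W, (le_max_left _ _).trans hW, hg⟩
  exact (measureReal_eq_zero_iff).1 (le_antisymm h measureReal_nonneg)

/-- A remainder term that controls the invariants when the window `W₀` fails: summing
`5 (W + 1) ^ 2` over the failing windows `W ≥ W₀` bounds `5 W ^ 2` at the first good one. The
geometric series of ratio `exp (-p / 8)` contributes the factor `16 / p`. -/
lemma exists_remainder {p : I} (hp : 0 < p) {W₀ : ℕ} (hW₀ : 1 ≤ W₀) :
    ∃ R : Set ℕ → ℝ, Integrable R (randomSet p) ∧ (∀ A, 0 ≤ R A) ∧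
      ∫ A, R A ∂(randomSet p) ≤ 3774873600 * (p : ℝ)⁻¹ ^ 6 * Real.exp (-(p * W₀ / 8)) ∧
      ∀ᵐ A ∂(randomSet p), ∃ W, W₀ ≤ W ∧ GoodWindow p W A ∧ (W = W₀ ∨ 5 * (W : ℝ) ^ 2 ≤ R A) := by
  have hp0 : (0 : ℝ) < p := hp
  have hp1 : (p : ℝ) ≤ 1 := p.2.2
  let a : ℕ → ℝ := fun k => 5 * (((W₀ + k : ℕ) : ℝ) + 1) ^ 2
  have ha : ∀ k, 0 ≤ a k := fun k => by positivity
  let E : ℕ → Set (Set ℕ) := fun k => {A | ¬ GoodWindow p (W₀ + k) A}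
  have hE : ∀ k, MeasurableSet (E k) := fun k => (measurableSet_goodWindow p (W₀ + k)).compl
  let f : ℕ → Set ℕ → ENNReal := fun k => (E k).indicator fun _ => ENNReal.ofReal (a k)
  have hf : ∀ k, Measurable (f k) := fun k => measurable_const.indicator (hE k)
  let r : ℝ := Real.exp (-(p / 8))
  have hr0 : 0 ≤ r := (Real.exp_pos _).le
  have hr1 : r ≤ 1 - p / 16 := by
    have h1 : r ≤ 1 / (1 + p / 8) := by
      simp only [r]
      rw [Real.exp_neg, inv_eq_one_div]
      exact one_div_le_one_div_of_le (by positivity) (by linarith [Real.add_one_le_exp (p / 8 : ℝ)])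
    refine h1.trans ?_
    rw [div_le_iff₀ (by positivity)]
    nlinarith
  have hrlt : r < 1 := by linarith
  let b : ℝ := 235929600 * (p : ℝ)⁻¹ ^ 5 * Real.exp (-(p * W₀ / 8))
  have hb : 0 ≤ b := by positivity
  have hk : ∀ k, ∫⁻ A, f k A ∂(randomSet p) ≤ ENNReal.ofReal (b * r ^ k) := by
    intro k
    rw [lintegral_indicator_const (hE k), ← ofReal_measureReal, ← ENNReal.ofReal_mul (ha k)]
    refine ENNReal.ofReal_le_ofReal ((sq_mul_measureReal_not_goodWindow_le hp
      (by omega : 1 ≤ W₀ + k)).trans (le_of_eq ?_))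
    simp only [b, r]
    rw [← Real.exp_nat_mul, mul_assoc _ (Real.exp _) (Real.exp _), ← Real.exp_add]
    congr 2
    push_cast
    ring
  have hsum : ∑' k, b * r ^ k ≤ 3774873600 * (p : ℝ)⁻¹ ^ 6 * Real.exp (-(p * W₀ / 8)) := by
    rw [tsum_mul_left, tsum_geometric_of_lt_one hr0 hrlt]
    have h1 : (1 - r)⁻¹ ≤ 16 * (p : ℝ)⁻¹ := by
      rw [show 16 * (p : ℝ)⁻¹ = (p / 16 : ℝ)⁻¹ by field_simp]
      exact inv_anti₀ (by positivity) (by linarith)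
    refine (mul_le_mul_of_nonneg_left h1 hb).trans (le_of_eq ?_)
    simp only [b]
    ring
  have hsummable : Summable fun k => b * r ^ k :=
    (summable_geometric_of_lt_one hr0 hrlt).mul_left b
  have hlint : ∫⁻ A, ∑' k, f k A ∂(randomSet p) ≤ ENNReal.ofReal (∑' k, b * r ^ k) := by
    rw [lintegral_tsum fun k => (hf k).aemeasurable,
      ENNReal.ofReal_tsum_of_nonneg (fun k => mul_nonneg hb (pow_nonneg hr0 k)) hsummable]
    exact ENNReal.tsum_le_tsum hk
  have hmeas : Measurable fun A => ∑' k, f k A := Measurable.tsum hf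
  have hne : ∫⁻ A, ∑' k, f k A ∂(randomSet p) ≠ ⊤ := ne_top_of_le_ne_top ENNReal.ofReal_ne_top hlint
  have hfin := ae_lt_top hmeas hne
  refine ⟨fun A => (∑' k, f k A).toReal, integrable_toReal_of_lintegral_ne_top hmeas.aemeasurable hne,
    fun A => ENNReal.toReal_nonneg, ?_, ?_⟩
  · rw [integral_toReal hmeas.aemeasurable hfin]
    exact (ENNReal.toReal_le_of_le_ofReal
      (tsum_nonneg fun k => mul_nonneg hb (pow_nonneg hr0 k)) hlint).trans hsum
  · filter_upwards [ae_exists_goodWindow hp W₀, hfin] with A hA hAfin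
    classical
    have hmin := fun k => Nat.find_min hA (m := k)
    obtain ⟨h1, h2⟩ := Nat.find_spec hA
    refine ⟨Nat.find hA, h1, h2, ?_⟩
    rcases eq_or_lt_of_le h1 with h3 | h3
    · exact Or.inl h3.symm
    right
    -- the window just before the first good one fails, so its term occurs in the sum
    obtain ⟨k, hk⟩ : ∃ k, Nat.find hA = W₀ + k + 1 := ⟨Nat.find hA - W₀ - 1, by omega⟩
    have h4 : A ∈ E k := fun hg => hmin (W₀ + k) (by omega) ⟨by omega, hg⟩
    have h5 : ENNReal.ofReal (a k) ≤ ∑' k, f k A := by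
      refine le_trans (le_of_eq ?_) (ENNReal.le_tsum k)
      simp only [f]
      rw [Set.indicator_of_mem h4]
    have h6 := ENNReal.toReal_mono hAfin.ne h5
    rw [ENNReal.toReal_ofReal (ha k)] at h6
    rw [hk]
    simpa only [a, Nat.cast_add, Nat.cast_one] using h6

/-- A quantity that is at most `Φ` when the window `W₀` is good, and at most `5 W ^ 2` on any later
good window, has expectation at most that of `Φ`, up to an error that is small for large `W₀`. -/
lemma integrable_and_integral_le {p : I} (hp : 0 < p) {W₀ : ℕ} (hW₀ : 1 ≤ W₀)
    {f Φ : Set ℕ → ℝ} (hf : Measurable f) (hf' : ∀ A, -1 ≤ f A)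
    (hΦ : Integrable Φ (randomSet p)) (hΦ' : ∀ A, 0 ≤ Φ A)
    (h0 : ∀ A, GoodWindow p W₀ A → f A ≤ Φ A)
    (h1 : ∀ W A, W₀ ≤ W → GoodWindow p W A → f A ≤ 5 * (W : ℝ) ^ 2) :
    Integrable f (randomSet p) ∧ ∫ A, f A ∂(randomSet p) ≤ ∫ A, Φ A ∂(randomSet p) +
      3774873600 * (p : ℝ)⁻¹ ^ 6 * Real.exp (-(p * W₀ / 8)) := by
  obtain ⟨R, hR, hR0, hRint, hRae⟩ := exists_remainder hp hW₀
  have hle : ∀ᵐ A ∂(randomSet p), f A ≤ Φ A + R A := by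
    filter_upwards [hRae] with A ⟨W, hW, hgood, hcase⟩
    rcases hcase with rfl | h
    · linarith [h0 A hgood, hR0 A]
    · linarith [h1 W A hW hgood, hΦ' A]
  have hint : Integrable f (randomSet p) := by
    refine Integrable.mono' ((hΦ.add hR).add (integrable_const (1 : ℝ))) hf.aestronglyMeasurable ?_
    filter_upwards [hle] with A hA
    simp only [Pi.add_apply, Real.norm_eq_abs]
    rw [abs_le]
    constructor <;> linarith [hf' A, hΦ' A, hR0 A]
  refine ⟨hint, (integral_mono_ae hint (hΦ.add hR) hle).trans ?_⟩
  simp only [Pi.add_apply]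
  rw [integral_add hΦ hR]
  linarith

/-! ### The scale `log p⁻¹` -/

/-- `L = log p⁻¹`, and `p` is small enough for all the estimates below. The threshold is a convenient
one for which `L ^ 2 / 3200 ≥ L`, so that the number of elements of `A` up to `sparseBound p L` is
concentrated, and for which the constant of `exists_remainder` is at most `exp L`. -/
structure IsScale (p : I) (L : ℝ) : Prop where
  eq_exp : (p : ℝ) = Real.exp (-L)
  large : 3200 ≤ L

namespace IsScale

variable {p : I} {L : ℝ}

lemma pos (h : IsScale p L) : (0 : ℝ) < p := h.eq_exp ▸ Real.exp_pos _

lemma pos_scale (h : IsScale p L) : 0 < L := by linarith [h.large]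

lemma log_inv (h : IsScale p L) : Real.log (p : ℝ)⁻¹ = L := by
  rw [h.eq_exp, ← Real.exp_neg, neg_neg, Real.log_exp]

lemma inv_pow (h : IsScale p L) (k : ℕ) : (p : ℝ)⁻¹ ^ k = Real.exp (k * L) := by
  rw [h.eq_exp, ← Real.exp_neg, neg_neg, ← Real.exp_nat_mul]

lemma between_scaleFG (h : IsScale p L) {c C y : ℝ} (h1 : c * L ^ 2 ≤ p * y)
    (h2 : p * y ≤ C * L ^ 2) : Between c C (scaleFG p) y := by
  unfold Between scaleFG
  rw [h.log_inv]
  have hp := h.pos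
  constructor
  · rw [mul_left_comm, inv_mul_le_iff₀ hp]; exact h1
  · rw [mul_left_comm, le_inv_mul_iff₀ hp]; exact h2

lemma between_scaleE (h : IsScale p L) {c C y : ℝ} (h1 : c * L ^ 2 ≤ y)
    (h2 : y ≤ C * L ^ 2) : Between c C (scaleE p) y := by
  unfold Between scaleE
  rw [h.log_inv]
  exact ⟨h1, h2⟩

end IsScale

/-- The length of a window that is good with high probability, about `56 p⁻¹ L`. The factor makes
`exp (-p W / 8)` at most `p ^ 7`, which beats the factor `p⁻¹ ^ 6` in `exists_remainder`. -/
noncomputable def window (p : I) (L : ℝ) : ℕ := ⌈56 * L / p⌉₊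

/-- A bound from which on everything lies in `⟨A⟩` if the window `window p L` is good; the minimal
generators are then at most `conductorBound p L + window p L`. -/
noncomputable def conductorBound (p : I) (L : ℝ) : ℕ := ⌈3 * (p : ℝ) * window p L ^ 2⌉₊

/-- A bound of order `p⁻¹ L ^ 2` below which most integers are gaps. With the factor `40` and
`M = p⁻¹ L / 40` the exponential factor in `integral_countUpTo_gen_le` is at most `p ^ (-1 / 8)`. -/
noncomputable def sparseBound (p : I) (L : ℝ) : ℕ := ⌊(L / 40) ^ 2 / p⌋₊

/-- The numerical semigroups that obey the bounds on all three invariants at density `p`. -/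
def typicalSemigroups (p : I) : Set (AddSubmonoid ℕ) := {S | IsNumericalSemigroup S ∧
  Between (1 / 12800) 30000 (scaleFG p) (genus S) ∧
  Between (1 / 12800) 30000 (scaleFG p) (frobeniusNum S) ∧
  Between (1 / 12800) 30000 (scaleE p) (embDim S)}

namespace IsScale

variable {p : I} {L : ℝ}

lemma le_mul_window (h : IsScale p L) : 56 * L ≤ (p : ℝ) * window p L := by
  have h1 := Nat.le_ceil (56 * L / p)
  rw [div_le_iff₀ h.pos] at h1
  exact h1.trans_eq (mul_comm _ _)

lemma mul_window_le (h : IsScale p L) : (p : ℝ) * window p L ≤ 57 * L := by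
  have hp := h.pos
  have h1 := (Nat.ceil_lt_add_one (div_nonneg (by linarith [h.pos_scale] : 0 ≤ 56 * L) hp.le)).le
  have h2 := mul_le_mul_of_nonneg_left h1 hp.le
  rw [mul_add, mul_div_cancel₀ _ hp.ne', mul_one] at h2
  have h3 := p.2.2
  have h4 := h.large
  exact h2.trans (by linarith : 56 * L + (p : ℝ) ≤ 57 * L)

lemma one_le_window (h : IsScale p L) : 1 ≤ window p L :=
  Nat.ceil_pos.2 (div_pos (by linarith [h.pos_scale]) h.pos)

lemma mul_three_mul_sq_le (h : IsScale p L) : (p : ℝ) * (3 * p * window p L ^ 2) ≤ 9747 * L ^ 2 := by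
  have h1 := h.mul_window_le
  have h2 := mul_nonneg h.pos.le (Nat.cast_nonneg (α := ℝ) (window p L))
  nlinarith

lemma mul_conductorBound_add_le (h : IsScale p L) :
    p * ((conductorBound p L + window p L : ℕ) : ℝ) ≤ 10000 * L ^ 2 := by
  have h1 := (Nat.ceil_lt_add_one (three_mul_sq_nonneg p (window p L))).le
  have h2 := mul_le_mul_of_nonneg_left h1 h.pos.le
  have h3 := h.mul_three_mul_sq_le
  have h4 := h.mul_window_le
  have h5 := h.large
  have h6 := p.2.2
  have h7 : p * (conductorBound p L : ℝ) ≤ p * (3 * p * window p L ^ 2 + 1) := h2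
  push_cast
  nlinarith

lemma le_mul_sparseBound (h : IsScale p L) : L ^ 2 / 3200 ≤ p * sparseBound p L := by
  have hp := h.pos
  have h1 := (Nat.lt_floor_add_one ((L / 40) ^ 2 / p)).le
  rw [div_le_iff₀ hp] at h1
  have h2 := p.2.2
  have h3 := h.large
  have h4 : (L / 40) ^ 2 ≤ (sparseBound p L + 1) * (p : ℝ) := h1
  nlinarith

lemma mul_sparseBound_le (h : IsScale p L) : (p : ℝ) * sparseBound p L ≤ L ^ 2 / 1600 := by
  have hp := h.pos
  have h1 := Nat.floor_le (div_nonneg (sq_nonneg (L / 40)) hp.le)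
  rw [le_div_iff₀ hp] at h1
  have h2 : sparseBound p L * (p : ℝ) ≤ (L / 40) ^ 2 := h1
  linarith

lemma le_mul_sparseBound' (h : IsScale p L) : L ≤ p * sparseBound p L := by
  have h1 := h.le_mul_sparseBound
  have h2 := h.large
  nlinarith

/-- The expected number of elements of `⟨A⟩` below the bound is `o(p⁻¹)`, even after the loss of a
factor `L` that comes from `√(sparseBound p L)`. -/
lemma mul_integral_countUpTo_gen_le (h : IsScale p L) :
    p * ∫ A, (countUpTo (gen A : Set ℕ) (sparseBound p L) : ℝ) ∂(randomSet p) ≤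
      8 * Real.exp (-(L / 4)) := by
  have hp := h.pos
  have hL := h.large
  have hL0 := h.pos_scale
  have h1 := integral_countUpTo_gen_le p (sparseBound p L) (M := L / 40 / p)
    ((le_div_iff₀ hp).2 (by linarith [p.2.2]))
  have h2 : sparseBound p L / (2 * (L / 40 / p)) + 4 * p * (L / 40 / p) ≤ L / 8 := by
    have e1 : (sparseBound p L : ℝ) / (2 * (L / 40 / p)) = p * sparseBound p L * 20 / L := by
      field_simp; ring
    have e2 : 4 * (p : ℝ) * (L / 40 / p) = L / 10 := by field_simp; norm_num
    have e3 : (p : ℝ) * sparseBound p L * 20 / L ≤ L / 80 := by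
      rw [div_le_iff₀ hL0]
      linarith [h.mul_sparseBound_le]
    linarith
  have h3 : √(sparseBound p L) ≤ L / 40 * Real.exp (L / 2) := by
    refine Real.sqrt_le_iff.2 ⟨by positivity, ?_⟩
    have e1 := Nat.floor_le (div_nonneg (sq_nonneg (L / 40)) hp.le)
    refine e1.trans (le_of_eq ?_)
    rw [mul_pow, ← Real.exp_nat_mul, h.eq_exp, div_eq_mul_inv, ← Real.exp_neg, neg_neg]
    congr 2
    push_cast
    ring
  have h4 : L ≤ 8 * Real.exp (L / 8) := by linarith [Real.add_one_le_exp (L / 8)]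
  have h5 : √(sparseBound p L) *
      Real.exp (sparseBound p L / (2 * (L / 40 / p)) + 4 * p * (L / 40 / p)) ≤
      (8 * Real.exp (L / 8) * Real.exp (L / 2)) * Real.exp (L / 8) := by
    refine mul_le_mul (h3.trans ?_) (Real.exp_le_exp.2 h2) (Real.exp_pos _).le (by positivity)
    refine mul_le_mul_of_nonneg_right ?_ (Real.exp_pos _).le
    linarith
  refine (mul_le_mul_of_nonneg_left (h1.trans h5) hp.le).trans (le_of_eq ?_)
  rw [h.eq_exp]
  have e1 : Real.exp (-(L / 4)) =
      Real.exp (-L) * (Real.exp (L / 8) * Real.exp (L / 2) * Real.exp (L / 8)) := by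
    rw [← Real.exp_add, ← Real.exp_add, ← Real.exp_add]
    ring_nf
  rw [e1]
  ring

lemma exp_neg_quarter_le (h : IsScale p L) : Real.exp (-(L / 4)) ≤ 1 :=
  Real.exp_le_one_iff.2 (by linarith [h.pos_scale])

lemma exp_mul_window_le (h : IsScale p L) :
    Real.exp (-(p * window p L / 8)) ≤ Real.exp (-(7 * L)) :=
  Real.exp_le_exp.2 (by linarith [h.le_mul_window])

lemma remainder_le_one (h : IsScale p L) :
    3774873600 * (p : ℝ)⁻¹ ^ 6 * Real.exp (-(p * window p L / 8)) ≤ 1 := by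
  have hL := h.large
  have h1 : 3774873600 ≤ Real.exp L := by
    have h2 := Real.pow_div_factorial_le_exp L h.pos_scale.le 3
    have h3 : (3200 : ℝ) ^ 3 ≤ L ^ 3 := by gcongr
    have h4 : ((Nat.factorial 3 : ℕ) : ℝ) = 6 := by norm_num [Nat.factorial]
    rw [h4, div_le_iff₀ (by norm_num)] at h2
    linarith
  rw [h.inv_pow]
  calc 3774873600 * Real.exp ((6 : ℕ) * L) * Real.exp (-(p * window p L / 8))
      ≤ Real.exp L * Real.exp ((6 : ℕ) * L) * Real.exp (-(7 * L)) := by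
        gcongr ?_ * _ * ?_
        exact h.exp_mul_window_le
    _ = 1 := by
        rw [← Real.exp_add, ← Real.exp_add, Real.exp_eq_one_iff]
        push_cast
        ring

/-! ### The two parts of the theorem -/

/-- With high probability the five bad events are all avoided: the window fails, `⟨A⟩` is dense
below `sparseBound p L`, there are too few elements of `A` there, one of them is redundant, or
there are too many elements of `A` below the bound for the generators. -/
lemma measureReal_compl_le (h : IsScale p L) :
    (randomSet p).real {A | gen A ∈ typicalSemigroups p}ᶜ ≤
      235929618 * Real.exp (-(L / 4)) := by
  have hp := h.pos
  have hL := h.large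
  have hL0 := h.pos_scale
  set N := sparseBound p L with hN
  set W := window p L with hW
  set G := conductorBound p L + W with hG
  have hZ0 : ∀ A : Set ℕ, (0 : ℝ) ≤ countUpTo (gen A : Set ℕ) N := fun A => Nat.cast_nonneg _
  have hU0 : ∀ A : Set ℕ, (0 : ℝ) ≤ countUpTo (redundant A) N := fun A => Nat.cast_nonneg _
  have hpN := h.le_mul_sparseBound
  have hEZ := h.mul_integral_countUpTo_gen_le
  have h1 : (randomSet p).real {A | ¬ GoodWindow p W A} ≤ 235929600 * Real.exp (-(L / 4)) := by
    refine (measureReal_not_goodWindow_le' hp h.one_le_window).trans ?_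
    rw [h.inv_pow, mul_assoc]
    refine mul_le_mul_of_nonneg_left ?_ (by norm_num)
    refine (mul_le_mul_of_nonneg_left h.exp_mul_window_le (Real.exp_pos _).le).trans ?_
    rw [← Real.exp_add]
    refine Real.exp_le_exp.2 ?_
    push_cast
    linarith
  have h2 : (randomSet p).real {A | (N : ℝ) / 2 ≤ countUpTo (gen A : Set ℕ) N} ≤
      8 * Real.exp (-(L / 4)) := by
    have e1 := mul_meas_ge_le_integral_of_nonneg (ae_of_all _ hZ0)
      (integrable_countUpTo p (X := fun A => (gen A : Set ℕ)) measurableSet_mem_gen N) ((N : ℝ) / 2)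
    have e2 := mul_le_mul_of_nonneg_left e1 hp.le
    have e3 : 1 ≤ p * (N : ℝ) / 2 := by linarith [h.le_mul_sparseBound']
    have e4 := measureReal_nonneg (μ := randomSet p)
      (s := {A | (N : ℝ) / 2 ≤ countUpTo (gen A : Set ℕ) N})
    nlinarith
  have h3 : (randomSet p).real {A | (countUpTo A N : ℝ) ≤ p * N / 4} ≤ 1 * Real.exp (-(L / 4)) := by
    rw [one_mul]
    exact (measureReal_countUpTo_le_le p N).trans
      (Real.exp_le_exp.2 (by linarith [h.le_mul_sparseBound']))
  have h4 : (randomSet p).real {A | (1 : ℝ) ≤ countUpTo (redundant A) N} ≤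
      8 * Real.exp (-(L / 4)) := by
    have e1 := mul_meas_ge_le_integral_of_nonneg (ae_of_all _ hU0)
      (integrable_countUpTo p measurableSet_mem_redundant N) 1
    rw [one_mul] at e1
    exact e1.trans ((integral_countUpTo_redundant_le p N).trans hEZ)
  have h5 : (randomSet p).real {A | 3 * (p : ℝ) * G ≤ (countUpTo A G : ℝ)} ≤
      1 * Real.exp (-(L / 4)) := by
    rw [one_mul]
    refine (measureReal_countUpTo_ge_le p G).trans (Real.exp_le_exp.2 ?_)
    have e1 : (W : ℝ) ≤ G := by exact_mod_cast Nat.le_add_left _ _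
    have e2 := mul_le_mul_of_nonneg_left e1 hp.le
    linarith [h.le_mul_window]
  refine (measureReal_mono (s₂ := {A | ¬ GoodWindow p W A} ∪
    ({A | (N : ℝ) / 2 ≤ countUpTo (gen A : Set ℕ) N} ∪ ({A | (countUpTo A N : ℝ) ≤ p * N / 4} ∪
    ({A | (1 : ℝ) ≤ countUpTo (redundant A) N} ∪ {A | 3 * (p : ℝ) * G ≤ (countUpTo A G : ℝ)})))
    ) ?_).trans ?_
  · intro A hA
    by_contra hbad
    simp only [Set.mem_union, Set.mem_ofPred_eq, not_or, not_not, not_le] at hbad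
    obtain ⟨b1, b2, b3, b4, b5⟩ := hbad
    have hS := b1.isNumericalSemigroup
    have g1 : (N : ℝ) ≤ genus (gen A) + countUpTo (gen A : Set ℕ) N := by
      exact_mod_cast le_genus_add_countUpTo hS N
    have g2 : p * ((N : ℝ) / 2) ≤ p * (genus (gen A) : ℝ) :=
      mul_le_mul_of_nonneg_left (by linarith) hp.le
    have g3 := mul_le_mul_of_nonneg_left b1.genus_le hp.le
    have f1 : (genus (gen A) : ℝ) - 1 ≤ frobeniusNum (gen A) := by
      exact_mod_cast genus_sub_one_le_frobeniusNum hS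
    have f2 := mul_le_mul_of_nonneg_left f1 hp.le
    have f3 := mul_le_mul_of_nonneg_left b1.frobeniusNum_le hp.le
    have m1 := h.mul_three_mul_sq_le
    have m2 := h.mul_conductorBound_add_le
    have e1 : (countUpTo A N : ℝ) ≤ embDim (gen A) + countUpTo (redundant A) N := by
      exact_mod_cast countUpTo_le_embDim_add A N
    have e2 : (countUpTo (redundant A) N : ℝ) = 0 := by
      have : countUpTo (redundant A) N < 1 := by exact_mod_cast b4
      exact_mod_cast (by omega : countUpTo (redundant A) N = 0)
    have e3 : (embDim (gen A) : ℝ) ≤ countUpTo A G := Nat.cast_le.2 b1.embDim_le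
    have hp1 := p.2.2
    refine hA ⟨hS, h.between_scaleFG (by linarith) (by nlinarith), h.between_scaleFG ?_ ?_,
      h.between_scaleE (by linarith) (by linarith)⟩
    · nlinarith
    · nlinarith
  · have u1 := measureReal_union_le (μ := randomSet p) {A | ¬ GoodWindow p W A}
      ({A | (N : ℝ) / 2 ≤ countUpTo (gen A : Set ℕ) N} ∪ ({A | (countUpTo A N : ℝ) ≤ p * N / 4} ∪
      ({A | (1 : ℝ) ≤ countUpTo (redundant A) N} ∪ {A | 3 * (p : ℝ) * G ≤ (countUpTo A G : ℝ)})))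
    have u2 := measureReal_union_le (μ := randomSet p)
      {A | (N : ℝ) / 2 ≤ countUpTo (gen A : Set ℕ) N} ({A | (countUpTo A N : ℝ) ≤ p * N / 4} ∪
      ({A | (1 : ℝ) ≤ countUpTo (redundant A) N} ∪ {A | 3 * (p : ℝ) * G ≤ (countUpTo A G : ℝ)}))
    have u3 := measureReal_union_le (μ := randomSet p) {A | (countUpTo A N : ℝ) ≤ p * N / 4}
      ({A | (1 : ℝ) ≤ countUpTo (redundant A) N} ∪ {A | 3 * (p : ℝ) * G ≤ (countUpTo A G : ℝ)})
    have u4 := measureReal_union_le (μ := randomSet p)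
      {A | (1 : ℝ) ≤ countUpTo (redundant A) N} {A | 3 * (p : ℝ) * G ≤ (countUpTo A G : ℝ)}
    linarith

lemma integral_bounds (h : IsScale p L) :
    (Integrable (fun A : Set ℕ => (genus (gen A) : ℝ)) (randomSet p) ∧
      Integrable (fun A : Set ℕ => (frobeniusNum (gen A) : ℝ)) (randomSet p) ∧
      Integrable (fun A : Set ℕ => (embDim (gen A) : ℝ)) (randomSet p)) ∧
    Between (1 / 12800) 30000 (scaleFG p) (∫ A, (genus (gen A) : ℝ) ∂(randomSet p)) ∧
    Between (1 / 12800) 30000 (scaleFG p) (∫ A, (frobeniusNum (gen A) : ℝ) ∂(randomSet p)) ∧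
    Between (1 / 12800) 30000 (scaleE p) (∫ A, (embDim (gen A) : ℝ) ∂(randomSet p)) := by
  have hp := h.pos
  have hL := h.large
  have hp1 := p.2.2
  have hrem := h.remainder_le_one
  have hEZ := h.mul_integral_countUpTo_gen_le
  have hexp := h.exp_neg_quarter_le
  have hpN := h.le_mul_sparseBound
  have m1 := h.mul_three_mul_sq_le
  have m2 := h.mul_conductorBound_add_le
  have hEU := integral_countUpTo_redundant_le p (sparseBound p L)
  have hW1 := h.one_le_window
  have hF : ∀ A : Set ℕ, (-1 : ℝ) ≤ frobeniusNum (gen A) := fun A => by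
    have : (-1 : ℤ) ≤ frobeniusNum (gen A) := by unfold frobeniusNum; split_ifs <;> omega
    exact_mod_cast this
  obtain ⟨ig, ug⟩ := integrable_and_integral_le hp hW1
    (f := fun A => (genus (gen A) : ℝ)) (Φ := fun _ => 3 * (p : ℝ) * window p L ^ 2)
    (measurable_comp_gen fun S => (genus S : ℝ))
    (fun A => by linarith [Nat.cast_nonneg (α := ℝ) (genus (gen A))]) (integrable_const _)
    (fun _ => three_mul_sq_nonneg p _) (fun A hA => hA.genus_le)
    (fun W A _ hA => hA.genus_le.trans (three_mul_sq_le p W))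
  obtain ⟨iF, uF⟩ := integrable_and_integral_le hp hW1
    (f := fun A => (frobeniusNum (gen A) : ℝ)) (Φ := fun _ => 3 * (p : ℝ) * window p L ^ 2)
    (measurable_comp_gen fun S => (frobeniusNum S : ℝ)) hF (integrable_const _)
    (fun _ => three_mul_sq_nonneg p _) (fun A hA => hA.frobeniusNum_le)
    (fun W A _ hA => hA.frobeniusNum_le.trans (three_mul_sq_le p W))
  obtain ⟨ie, ue⟩ := integrable_and_integral_le hp hW1
    (f := fun A => (embDim (gen A) : ℝ))
    (Φ := fun A => (countUpTo A (conductorBound p L + window p L) : ℝ))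
    (measurable_comp_gen fun S => (embDim S : ℝ))
    (fun A => by linarith [Nat.cast_nonneg (α := ℝ) (embDim (gen A))])
    (integrable_countUpTo p (X := fun A => A) measurableSet_mem _)
    (fun _ => Nat.cast_nonneg _) (fun A hA => Nat.cast_le.2 hA.embDim_le)
    (fun W A hW hA => hA.embDim_le_sq (hW1.trans hW))
  rw [integral_countUpTo_self] at ue
  simp only [integral_const, probReal_univ, one_smul] at ug uF
  have iZ := integrable_countUpTo p (X := fun A => (gen A : Set ℕ)) measurableSet_mem_gen
    (sparseBound p L)
  have iX := integrable_countUpTo p (X := fun A => A) measurableSet_mem (sparseBound p L)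
  have iU := integrable_countUpTo p measurableSet_mem_redundant (sparseBound p L)
  have hS : ∀ᵐ A ∂(randomSet p), IsNumericalSemigroup (gen A) := by
    filter_upwards [ae_exists_goodWindow hp 0] with A ⟨W, _, hW⟩ using hW.isNumericalSemigroup
  have lg : (sparseBound p L : ℝ) -
      ∫ A, (countUpTo (gen A : Set ℕ) (sparseBound p L) : ℝ) ∂(randomSet p) ≤
      ∫ A, (genus (gen A) : ℝ) ∂(randomSet p) := by
    have e1 : ∫ A, ((sparseBound p L : ℝ) - countUpTo (gen A : Set ℕ) (sparseBound p L))
        ∂(randomSet p) ≤ ∫ A, (genus (gen A) : ℝ) ∂(randomSet p) := by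
      refine integral_mono_ae ((integrable_const _).sub iZ) ig ?_
      filter_upwards [hS] with A hA
      have : (sparseBound p L : ℝ) ≤
          genus (gen A) + countUpTo (gen A : Set ℕ) (sparseBound p L) := by
        exact_mod_cast le_genus_add_countUpTo hA _
      linarith
    rwa [integral_sub (integrable_const _) iZ, integral_const, probReal_univ, one_smul] at e1
  have lF : ∫ A, (genus (gen A) : ℝ) ∂(randomSet p) - 1 ≤
      ∫ A, (frobeniusNum (gen A) : ℝ) ∂(randomSet p) := by
    have e1 : ∫ A, ((genus (gen A) : ℝ) - 1) ∂(randomSet p) ≤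
        ∫ A, (frobeniusNum (gen A) : ℝ) ∂(randomSet p) := by
      refine integral_mono_ae (ig.sub (integrable_const _)) iF ?_
      filter_upwards [hS] with A hA
      exact_mod_cast genus_sub_one_le_frobeniusNum hA
    rwa [integral_sub ig (integrable_const _), integral_const, probReal_univ, one_smul] at e1
  have lowerE : p * (sparseBound p L : ℝ) -
      ∫ A, (countUpTo (redundant A) (sparseBound p L) : ℝ) ∂(randomSet p) ≤
      ∫ A, (embDim (gen A) : ℝ) ∂(randomSet p) := by
    rw [← integral_countUpTo_self, ← integral_sub iX iU]
    refine integral_mono (iX.sub iU) ie fun A => ?_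
    have : (countUpTo A (sparseBound p L) : ℝ) ≤
        embDim (gen A) + countUpTo (redundant A) (sparseBound p L) := by
      exact_mod_cast countUpTo_le_embDim_add A _
    simp only
    linarith
  have plg := mul_le_mul_of_nonneg_left lg hp.le
  have plF := mul_le_mul_of_nonneg_left lF hp.le
  have pug := mul_le_mul_of_nonneg_left ug hp.le
  have puF := mul_le_mul_of_nonneg_left uF hp.le
  have prem : (p : ℝ) * (3774873600 * (p : ℝ)⁻¹ ^ 6 * Real.exp (-(p * window p L / 8))) ≤ 1 := by
    refine (mul_le_mul hp1 hrem (by positivity) zero_le_one).trans (by norm_num)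
  rw [mul_sub] at plg plF
  rw [mul_add] at pug puF
  have hL2 : 3200 * 3200 ≤ L ^ 2 := by nlinarith
  exact ⟨⟨ig, iF, ie⟩, h.between_scaleFG (by linarith) (by linarith),
    h.between_scaleFG (by linarith) (by linarith), h.between_scaleE (by linarith) (by linarith)⟩

end IsScale

lemma tendsto_log_inv : Tendsto (fun p : I => Real.log (p : ℝ)⁻¹) (𝓝[>] 0) atTop := by
  refine Real.tendsto_log_atTop.comp (tendsto_inv_nhdsGT_zero.comp ?_)
  refine tendsto_nhdsWithin_iff.2 ⟨?_, ?_⟩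
  · exact (continuous_subtype_val.tendsto (0 : I)).mono_left nhdsWithin_le_nhds
  · filter_upwards [self_mem_nhdsWithin] with p hp
    exact hp

lemma eventually_isScale : ∀ᶠ p : I in 𝓝[>] 0, IsScale p (Real.log (p : ℝ)⁻¹) := by
  filter_upwards [self_mem_nhdsWithin, tendsto_log_inv.eventually_ge_atTop 3200] with p hp hL
  have hp0 : (0 : ℝ) < p := hp
  exact ⟨by rw [Real.log_inv, neg_neg, Real.exp_log hp0], hL⟩

end RandomSemigroup

open RandomSemigroup in
theorem theorem1p1 :
    -- almost surely the generated semigroup is a numerical semigroup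
    (∀ p : I, 0 < p → p < 1 → ∀ᵐ A ∂(randomSet p), IsNumericalSemigroup (gen A)) ∧
    ∃ c C : ℝ, 0 < c ∧ 0 < C ∧
      -- the statement with high probability
      Tendsto (fun p : I => randomSet p {A : Set ℕ |
          IsNumericalSemigroup (gen A) ∧
          Between c C (scaleFG p) (genus (gen A)) ∧
          Between c C (scaleFG p) (frobeniusNum (gen A)) ∧
          Between c C (scaleE p) (embDim (gen A))}) (𝓝[>] 0) (𝓝 1) ∧
      -- the statement for the expectations, which exist
      ∀ᶠ p : I in 𝓝[>] 0,
        (Integrable (fun A : Set ℕ => (genus (gen A) : ℝ)) (randomSet p) ∧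
          Integrable (fun A : Set ℕ => (frobeniusNum (gen A) : ℝ)) (randomSet p) ∧
          Integrable (fun A : Set ℕ => (embDim (gen A) : ℝ)) (randomSet p)) ∧
        Between c C (scaleFG p) (∫ A, (genus (gen A) : ℝ) ∂(randomSet p)) ∧
        Between c C (scaleFG p) (∫ A, (frobeniusNum (gen A) : ℝ) ∂(randomSet p)) ∧
        Between c C (scaleE p) (∫ A, (embDim (gen A) : ℝ) ∂(randomSet p)) := by
  refine ⟨fun p hp _ => ?_, 1 / 12800, 30000, by norm_num, by norm_num, ?_, ?_⟩
  · filter_upwards [ae_exists_goodWindow hp 0] with A ⟨W, _, hW⟩ using hW.isNumericalSemigroup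
  · have hlim : Tendsto (fun p : I => ENNReal.ofReal
        (1 - 235929618 * Real.exp (-(Real.log (p : ℝ)⁻¹ / 4)))) (𝓝[>] 0) (𝓝 1) := by
      rw [← ENNReal.ofReal_one]
      refine ENNReal.tendsto_ofReal ?_
      have h1 := (Real.tendsto_exp_neg_atTop_nhds_zero.comp
        (tendsto_log_inv.atTop_div_const (by norm_num : (0 : ℝ) < 4))).const_mul 235929618
      simpa using h1.const_sub 1
    refine tendsto_of_tendsto_of_tendsto_of_le_of_le' hlim tendsto_const_nhds ?_
      (Eventually.of_forall fun p => prob_le_one)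
    filter_upwards [eventually_isScale] with p hp
    rw [← ofReal_measureReal]
    refine ENNReal.ofReal_le_ofReal ?_
    have h1 := hp.measureReal_compl_le
    rw [probReal_compl_eq_one_sub (measurableSet_gen_mem _)] at h1
    change _ ≤ (randomSet p).real {A | gen A ∈ typicalSemigroups p}
    linarith
  · filter_upwards [eventually_isScale] with p hp using hp.integral_bounds
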